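/- Let $H_n=\mathbb C^n\times\mathbb R$ be the Heisenberg group with coordinates $(z,t)$, $z_\beta=x_\beta+iy_\beta$, contact form $\Theta=dt+\sum_\beta(x_\beta dy_\beta-y_\beta dx_\beta)$, contact bundle $\xi=\ker\Theta$, CR structure $J(\partial_{x_\beta}+y_\beta\partial_t)=\partial_{y_\beta}-x_\beta\partial_t$, $J^2=-1$ on $\xi$, and $T=\partial_t$. A pseudohermitian transformation between pseudohermitian manifolds is a diffeomorphism that preserves the contact forms and intertwines the CR structures on the contact bundles; the Heisenberg rigid motions are the pseudohermitian transformations of $H_n$ onto itself. A pseudohermitian submanifold of $H_n$ of CR dimension $m\ge 1$ is a pseudohermitian manifold $(M^{2m+1},\hat J,\hat\theta)$ immersed in $H_n$ such that $\hat\theta=\Theta|_M$ (so $\hat\xi=\ker\hat\theta=TM\cap\xi$) and $\hat J=J|_{\hat\xi}$. Its fundamental vector field is the horizontal field $\nu\perp\hat\xi$ with $T+\nu\in TM$; $M$ is vertical if $\nu\equiv0$. For a local unitary frame $Z_1,\dots,Z_n$ of $T_{1,0}H_n$ along $M$ with $Z_1,\dots,Z_m$ tangent to $M$ and $Z_{m+1},\dots,Z_n$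 normal (a Darboux frame), $\theta^\beta$ is the dual coframe and $\theta_\beta{}^\gamma$ are the connection forms of the (flat) pseudohermitian connection of $H_n$, restricted to $M$; the second fundamental form is $II=\sum\theta^j\otimes\theta_j{}^a\otimes Z_a$ (sum over $j\le m<a\le n$), and the normal connection is $\nabla^\perp Z_a=\sum_b\theta_a{}^b\otimes Z_b$. A point is flat if $II=0$ there. Let $m=n-1\ge1$, and let $M$ and $N$ be two simply connected vertical pseudohermitian submanifolds of $H_n$ of CR dimension $n-1$ without flat points, with immersions $\iota_M,\iota_N$. Then: (1) A diffeomorphism $\varphi:M\to N$ is a pseudohermitian transformation if and only if it is the restriction of a Heisenberg rigid motion, i.e. $\iota_N\circ\varphi=\Phi\circ\iota_M$ for some Heisenberg rigid motion $\Phi$. So the induced pseudohermitian structure is a complete invariant. (2) For every Darboux frame over an open $U\subset M$, the Tanaka-Webster connection forms $\hat\theta_j{}^k$ of $(Z_1,\dots,Z_m)$ exist on $U$, and, with $h_{jk}=II(Z_j,Z_k)$ (the coefficient of $Z_n$) and with $R_{j\bar lp\bar q}$ the Webster curvature of $(M,\hat J,\hat\theta)$, one has $h_{jk}=h_{kj}$,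 $\theta_j{}^n=\sum_kh_{jk}\theta^k$, the Gauss-like equation $$R_{j\bar lp\bar q}=-h_{jp}\,\overline{h_{lq}}$$ and the Codazzi-like equation $$d\theta_j{}^n=\sum_k\hat\theta_j{}^k\wedge\theta_k{}^n+\theta_j{}^n\wedge\theta_n{}^n .$$ At each point of $U$ the Gauss-like equation determines $(h_{jk})$ up to a common factor of modulus one (the choice of the unit normal $Z_n$), and, given $(\theta_j{}^n)$, the form $\theta_n{}^n$ of the normal connection is the only purely imaginary one-form that satisfies the Codazzi-like equation. (3) Consequently $II$ and $\nabla^\perp$ are determined by the induced structure: if $\varphi:M\to N$ is a pseudohermitian transformation, then every Darboux frame $(Z_j,Z_n)$ over an open $U\subset M$ has a counterpart $(\tilde Z_j,\tilde Z_n)$ over $\varphi(U)$ with $\tilde Z_j=\varphi_*Z_j$, $\tilde h_{jk}\circ\varphi=h_{jk}$ and $\varphi^*\tilde\theta_n{}^n=\theta_n{}^n$. -/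

import Mathlib

open scoped Manifold ContDiff

noncomputable section

namespace Pseudohermitian

/-! ### One-forms on a manifold modelled on a real normed space -/

section Forms

variable {E : Type*} [NormedAddCommGroup E] [NormedSpace ℝ E]
  {M : Type*} [TopologicalSpace M] [ChartedSpace E M]
  {F : Type*} [NormedAddCommGroup F] [NormedSpace ℝ F]

/-- The pullback of the `F`-valued one-form `κ` by the inverse of the chart around `x₀`. -/
def formInChart (κ : ∀ x : M, TangentSpace 𝓘(ℝ, E) x →L[ℝ] F) (x₀ : M) (y : E) : E →L[ℝ] F :=
  (κ ((extChartAt 𝓘(ℝ, E) x₀).symm y)).comp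
    (mfderiv 𝓘(ℝ, E) 𝓘(ℝ, E) (extChartAt 𝓘(ℝ, E) x₀).symm y)

/-- The one-form `κ` is smooth on `U`: its expressions in charts are smooth. -/
def SmoothFormOn (κ : ∀ x : M, TangentSpace 𝓘(ℝ, E) x →L[ℝ] F) (U : Set M) : Prop :=
  ∀ x₀ : M, ContDiffOn ℝ ∞ (formInChart κ x₀)
    ((extChartAt 𝓘(ℝ, E) x₀).target ∩ (extChartAt 𝓘(ℝ, E) x₀).symm ⁻¹' U)

/-- The value `dκ (v, w)` at `x` of the exterior derivative of the one-form `κ`, with the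
convention `dκ (X, Y) = X (κ Y) - Y (κ X) - κ [X, Y]`. It is computed in the chart around `x`,
through which Mathlib identifies the tangent space at `x` with the model space. -/
def extD (κ : ∀ x : M, TangentSpace 𝓘(ℝ, E) x →L[ℝ] F) (x : M)
    (v w : TangentSpace 𝓘(ℝ, E) x) : F :=
  let D : E →L[ℝ] E →L[ℝ] F := fderiv ℝ (formInChart κ x) (extChartAt 𝓘(ℝ, E) x x)
  D v w - D w v

/-- The expression in the chart around `x₀` of a field of endomorphisms of the tangent bundle. -/
def endoInChart (J : ∀ x : M, TangentSpace 𝓘(ℝ, E) x →L[ℝ] TangentSpace 𝓘(ℝ, E) x) (x₀ : M)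
    (y : E) : E →L[ℝ] E :=
  ((mfderiv 𝓘(ℝ, E) 𝓘(ℝ, E) (extChartAt 𝓘(ℝ, E) x₀)
      ((extChartAt 𝓘(ℝ, E) x₀).symm y)).comp (J ((extChartAt 𝓘(ℝ, E) x₀).symm y))).comp
    (mfderiv 𝓘(ℝ, E) 𝓘(ℝ, E) (extChartAt 𝓘(ℝ, E) x₀).symm y)

/-- `(α ∧ β) (v, w)` for complex-valued real-linear forms. -/
def wedge {V : Type*} [AddCommGroup V] [Module ℝ V] [TopologicalSpace V]
    (α β : V →L[ℝ] ℂ) (v w : V) : ℂ :=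
  α v * β w - α w * β v

end Forms

/-! ### Pseudohermitian manifolds -/

/-- A real one-form `θ` and a field `J` of endomorphisms of the tangent spaces. Only the
restriction of `J` to `ker θ` is geometric; as usual `J` is extended by `0` to the Reeb
direction. -/
structure PHData (E : Type*) [NormedAddCommGroup E] [NormedSpace ℝ E]
    (M : Type*) [TopologicalSpace M] [ChartedSpace E M] where
  θ : ∀ x : M, TangentSpace 𝓘(ℝ, E) x →L[ℝ] ℝ
  J : ∀ x : M, TangentSpace 𝓘(ℝ, E) x →L[ℝ] TangentSpace 𝓘(ℝ, E) x

section PH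

variable {E : Type*} [NormedAddCommGroup E] [NormedSpace ℝ E]
  {M : Type*} [TopologicalSpace M] [ChartedSpace E M]
  {E' : Type*} [NormedAddCommGroup E'] [NormedSpace ℝ E']
  {N : Type*} [TopologicalSpace N] [ChartedSpace E' N]

variable [IsManifold 𝓘(ℝ, E) ∞ M] in
/-- `(M, J, θ)` is a (strictly pseudoconvex) pseudohermitian manifold of CR dimension `m`. -/
structure PHData.IsPseudohermitian (S : PHData E M) (m : ℕ) : Prop where
  dim : Module.finrank ℝ E = 2 * m + 1
  smooth_θ : SmoothFormOn S.θ Set.univ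
  smooth_J : ∀ x₀ : M, ContDiffOn ℝ ∞ (endoInChart S.J x₀) (extChartAt 𝓘(ℝ, E) x₀).target
  θ_ne_zero : ∀ x, S.θ x ≠ 0
  J_mem : ∀ x v, S.θ x v = 0 → S.θ x (S.J x v) = 0
  J_sq : ∀ x v, S.θ x v = 0 → S.J x (S.J x v) = -v
  J_reeb : ∀ x v, (∀ w, extD S.θ x v w = 0) → S.J x v = 0
  levi_pos : ∀ x v, S.θ x v = 0 → v ≠ 0 → 0 < extD S.θ x v (S.J x v)
  integrable : ∀ U : Set M, IsOpen U → ∀ X Y : ∀ x : M, TangentSpace 𝓘(ℝ, E) x,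
    ContMDiffOn 𝓘(ℝ, E) 𝓘(ℝ, E).tangent ∞ (fun x => (X x : TangentBundle 𝓘(ℝ, E) M)) U →
    ContMDiffOn 𝓘(ℝ, E) 𝓘(ℝ, E).tangent ∞ (fun x => (Y x : TangentBundle 𝓘(ℝ, E) M)) U →
    (∀ x ∈ U, S.θ x (X x) = 0) → (∀ x ∈ U, S.θ x (Y x) = 0) → ∀ x ∈ U,
      let JX := fun y => S.J y (X y)
      let JY := fun y => S.J y (Y y)
      let A := VectorField.mlieBracket 𝓘(ℝ, E) X JY x + VectorField.mlieBracket 𝓘(ℝ, E) JX Y x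
      S.θ x A = 0 ∧
      S.J x A = VectorField.mlieBracket 𝓘(ℝ, E) JX JY x - VectorField.mlieBracket 𝓘(ℝ, E) X Y x

/-- A diffeomorphism `φ` is a pseudohermitian transformation if `φ^* θ' = θ` and
`φ_* ∘ J = J' ∘ φ_*` on the contact bundle `ker θ`. -/
def IsPHTransformation (S : PHData E M) (S' : PHData E' N)
    (φ : M ≃ₘ^∞⟮𝓘(ℝ, E), 𝓘(ℝ, E')⟯ N) : Prop :=
  (∀ x v, S'.θ (φ x) (mfderiv 𝓘(ℝ, E) 𝓘(ℝ, E') φ x v) = S.θ x v) ∧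
  (∀ x v, S.θ x v = 0 →
    mfderiv 𝓘(ℝ, E) 𝓘(ℝ, E') φ x (S.J x v) = S'.J (φ x) (mfderiv 𝓘(ℝ, E) 𝓘(ℝ, E') φ x v))

/-- The frame `Z_j = (e_j - i J e_j) / 2` of `T_{1,0}` over `U` is unitary with dual coframe `η`
(`η^j` is of type `(1,0)` and annihilates the Reeb field, and `dθ = i ∑ η^j ∧ conj η^j`), and
`Γ j k = Γ_j^k` and `τ^j = ∑ A j k conj η^k` are its pseudohermitian (Tanaka-Webster) connection
and torsion forms. -/
structure IsWebsterConnection (S : PHData E M) {m : ℕ} (U : Set M)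
    (e : Fin m → ∀ x : M, TangentSpace 𝓘(ℝ, E) x)
    (η : Fin m → ∀ x : M, TangentSpace 𝓘(ℝ, E) x →L[ℝ] ℂ)
    (Γ : Fin m → Fin m → ∀ x : M, TangentSpace 𝓘(ℝ, E) x →L[ℝ] ℂ)
    (A : Fin m → Fin m → M → ℂ) : Prop where
  smooth_η : ∀ j, SmoothFormOn (η j) U
  smooth_Γ : ∀ j k, SmoothFormOn (Γ j k) U
  horizontal : ∀ x ∈ U, ∀ j, S.θ x (e j x) = 0
  dual : ∀ x ∈ U, ∀ j k, η j x (e k x) = if j = k then 1 else 0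
  type_one_zero : ∀ x ∈ U, ∀ j v, η j x (S.J x v) = Complex.I * η j x v
  unitary : ∀ x ∈ U, ∀ v w, ((extD S.θ x v w : ℝ) : ℂ) =
    Complex.I * ∑ j, (η j x v * (starRingEnd ℂ) (η j x w) - η j x w * (starRingEnd ℂ) (η j x v))
  structure_eq : ∀ x ∈ U, ∀ j v w, extD (η j) x v w =
    (∑ k, wedge (η k x) (Γ k j x) v w) +
      ∑ k, A j k x * (S.θ x v * (starRingEnd ℂ) (η k x w) - S.θ x w * (starRingEnd ℂ) (η k x v))
  skew : ∀ x ∈ U, ∀ j k v, Γ j k x v + (starRingEnd ℂ) (Γ k j x v) = 0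

/-- The coefficient `R_{j \bar l p \bar q} = Π_j^l (Z_p, \bar Z_q)` of the Webster curvature with
respect to the unitary frame `Z_j = (e_j - i J e_j) / 2` with connection forms `Γ`, where
`Π_j^l = dΓ_j^l - ∑ Γ_j^k ∧ Γ_k^l`. -/
def websterCurvature (S : PHData E M) {m : ℕ} (e : Fin m → ∀ x : M, TangentSpace 𝓘(ℝ, E) x)
    (Γ : Fin m → Fin m → ∀ x : M, TangentSpace 𝓘(ℝ, E) x →L[ℝ] ℂ) (x : M)
    (j l p q : Fin m) : ℂ :=
  let P : TangentSpace 𝓘(ℝ, E) x → TangentSpace 𝓘(ℝ, E) x → ℂ := fun v w =>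
    extD (Γ j l) x v w - ∑ k, wedge (Γ j k x) (Γ k l x) v w
  (1 / 4) * (P (e p x) (e q x) + Complex.I * P (e p x) (S.J x (e q x))
    - Complex.I * P (S.J x (e p x)) (e q x) + P (S.J x (e p x)) (S.J x (e q x)))

end PH

/-! ### The Heisenberg group -/

/-- The manifold `H_n = ℂⁿ × ℝ`, with points `(z, t)`, `z = x + i y`. -/
abbrev Heis (n : ℕ) : Type := EuclideanSpace ℂ (Fin n) × ℝ

/-- The contact form `Θ = dt + ∑ (x_β dy_β - y_β dx_β)` at `p`. -/
def heisΘ {n : ℕ} (p : Heis n) : Heis n →L[ℝ] ℝ :=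
  ContinuousLinearMap.snd ℝ (EuclideanSpace ℂ (Fin n)) ℝ +
    (Complex.imCLM.comp ((innerSL ℂ p.1).restrictScalars ℝ)).comp
      (ContinuousLinearMap.fst ℝ (EuclideanSpace ℂ (Fin n)) ℝ)

/-- Multiplication by `i` on `ℂⁿ`. -/
def mulI (n : ℕ) : EuclideanSpace ℂ (Fin n) →L[ℝ] EuclideanSpace ℂ (Fin n) :=
  (Complex.I • ContinuousLinearMap.id ℂ (EuclideanSpace ℂ (Fin n))).restrictScalars ℝ

/-- The CR structure of `H_n`: it exchanges the left invariant fields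
`∂/∂x_β + y_β ∂/∂t ↦ ∂/∂y_β - x_β ∂/∂t ↦ -(∂/∂x_β + y_β ∂/∂t)` and annihilates `T = ∂/∂t`; that
is, `(v, s)` goes to the horizontal lift of `i v`. -/
def heisJ {n : ℕ} (p : Heis n) : Heis n →L[ℝ] Heis n :=
  ((mulI n).comp (ContinuousLinearMap.fst ℝ (EuclideanSpace ℂ (Fin n)) ℝ)).prod
    (-((Complex.imCLM.comp ((innerSL ℂ p.1).restrictScalars ℝ)).comp
      ((mulI n).comp (ContinuousLinearMap.fst ℝ (EuclideanSpace ℂ (Fin n)) ℝ))))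

/-- The standard pseudohermitian structure of `H_n`. -/
def heisenberg (n : ℕ) : PHData (Heis n) (Heis n) where
  θ p := heisΘ p
  J p := heisJ p

/-- The Heisenberg rigid motions: the pseudohermitian transformations of `H_n`. -/
def IsRigidMotion {n : ℕ} (Φ : Heis n ≃ₘ^∞⟮𝓘(ℝ, Heis n), 𝓘(ℝ, Heis n)⟯ Heis n) : Prop :=
  IsPHTransformation (heisenberg n) (heisenberg n) Φ

/-! ### Pseudohermitian submanifolds of the Heisenberg group

The contact bundle of `H_n` is trivialized by the left invariant unitary frame
`\mathring Z_β = (1/2) (\mathring e_β - i J \mathring e_β)`: the horizontal vector `(v, s)`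
corresponds to `∑ v_β \mathring Z_β`, so that `T_{1,0} H_n = H_n × ℂⁿ`, with the standard Hermitian
product, and the pseudohermitian connection of `H_n`, for which this frame is parallel, is the
componentwise derivative. -/

/-- The model space of manifolds of dimension `2 m + 1`. -/
abbrev Model (m : ℕ) : Type := EuclideanSpace ℝ (Fin (2 * m + 1))

section Submanifold

variable {m n : ℕ} {M : Type*} [TopologicalSpace M] [ChartedSpace (Model m) M]

/-- The differential of `ι : M → H_n`. -/
def push (ι : M → Heis n) (x : M) : TangentSpace 𝓘(ℝ, Model m) x →L[ℝ] Heis n :=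
  mfderiv 𝓘(ℝ, Model m) 𝓘(ℝ, Heis n) ι x

/-- The differential of the `ℂⁿ`-component of `ι`. On horizontal vectors `v` it gives the
components of `ι_* v` in the left invariant frame. -/
def dz (ι : M → Heis n) (x : M) :
    TangentSpace 𝓘(ℝ, Model m) x →L[ℝ] EuclideanSpace ℂ (Fin n) :=
  (ContinuousLinearMap.fst ℝ (EuclideanSpace ℂ (Fin n)) ℝ).comp (push ι x)

/-- The differential of a map `ζ : M → ℂⁿ`. -/
def dvec (ζ : M → EuclideanSpace ℂ (Fin n)) (x : M) :
    TangentSpace 𝓘(ℝ, Model m) x →L[ℝ] EuclideanSpace ℂ (Fin n) :=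
  mfderiv 𝓘(ℝ, Model m) 𝓘(ℝ, EuclideanSpace ℂ (Fin n)) ζ x

variable [IsManifold 𝓘(ℝ, Model m) ∞ M] in
/-- `(M, J, θ)`, immersed in `H_n` by `ι`, is a pseudohermitian submanifold of CR dimension `m`:
the contact form and the CR structure of `M` are the restrictions of those of `H_n`. -/
structure IsPHSubmanifold (S : PHData (Model m) M) (ι : M → Heis n) : Prop where
  pseudohermitian : S.IsPseudohermitian m
  smooth : ContMDiff 𝓘(ℝ, Model m) 𝓘(ℝ, Heis n) ∞ ι
  immersion : ∀ x : M, Function.Injective (push (m := m) ι x)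
  θ_eq : ∀ x v, S.θ x v = heisΘ (ι x) (push ι x v)
  J_eq : ∀ x v, S.θ x v = 0 → push ι x (S.J x v) = heisJ (ι x) (push ι x v)

/-- `ν` is the fundamental vector at `x`: it is horizontal, orthogonal to the contact space of
`M`, and `T + ν` is tangent to `M`. -/
def IsFundamentalVector (S : PHData (Model m) M) (ι : M → Heis n) (x : M) (ν : Heis n) : Prop :=
  heisΘ (ι x) ν = 0 ∧
  (∀ v, S.θ x v = 0 → (inner ℂ (dz ι x v) ν.1).re = 0) ∧
  ∃ v : TangentSpace 𝓘(ℝ, Model m) x, push ι x v = ((0, 1) : Heis n) + ν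

/-- The submanifold is vertical: its fundamental vector field vanishes identically. -/
def IsVertical (S : PHData (Model m) M) (ι : M → Heis n) : Prop :=
  ∀ x, IsFundamentalVector S ι x 0

/-- `ζ` is a smooth section over `U` of the normal bundle: the orthogonal complement of the
`(1,0)` contact bundle of `M` in that of `H_n`. -/
def IsNormalOn (S : PHData (Model m) M) (ι : M → Heis n) (U : Set M)
    (ζ : M → EuclideanSpace ℂ (Fin n)) : Prop :=
  ContMDiffOn 𝓘(ℝ, Model m) 𝓘(ℝ, EuclideanSpace ℂ (Fin n)) ∞ ζ U ∧
  ∀ x ∈ U, ∀ v, S.θ x v = 0 → inner ℂ (dz ι x v) (ζ x) = 0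

/-- The component `II^ζ (X, Y) = -⟨X_{1,0}, ∇_{\bar Y_{1,0}} ζ⟩` of the second fundamental form
along the normal section `ζ`, where `X, Y` are contact vectors of `M`,
`X_{1,0} = (X - i J X) / 2`, and `⟨ , ⟩` is linear in the first variable. -/
def secondForm (S : PHData (Model m) M) (ι : M → Heis n) (ζ : M → EuclideanSpace ℂ (Fin n))
    (x : M) (X Y : TangentSpace 𝓘(ℝ, Model m) x) : ℂ :=
  -inner ℂ ((1 / 2 : ℂ) • (dvec ζ x Y + Complex.I • dvec ζ x (S.J x Y))) (dz ι x X)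

/-- The point `x` is flat: the second fundamental form vanishes at `x`. -/
def IsFlatPoint (S : PHData (Model m) M) (ι : M → Heis n) (x : M) : Prop :=
  ∀ U : Set M, IsOpen U → x ∈ U → ∀ ζ, IsNormalOn S ι U ζ →
    ∀ X Y, S.θ x X = 0 → S.θ x Y = 0 → secondForm S ι ζ x X Y = 0

/-- A Darboux frame over `U` in CR codimension one: `e_j` are smooth contact fields of `M`, `ζ` is
a smooth normal section, and the vectors `Z_1 = ι_* e_1, …, Z_m = ι_* e_m, Z_{m+1} = ζ` of
`T_{1,0} H_{m+1}` form a unitary frame. -/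
structure IsDarbouxFrame (S : PHData (Model m) M) (ι : M → Heis (m + 1)) (U : Set M)
    (e : Fin m → ∀ x : M, TangentSpace 𝓘(ℝ, Model m) x)
    (ζ : M → EuclideanSpace ℂ (Fin (m + 1))) : Prop where
  horizontal : ∀ x ∈ U, ∀ j, S.θ x (e j x) = 0
  smooth : ∀ j, ContMDiffOn 𝓘(ℝ, Model m) 𝓘(ℝ, EuclideanSpace ℂ (Fin (m + 1))) ∞
    (fun x => dz ι x (e j x)) U
  orthonormal : ∀ x ∈ U, Orthonormal ℂ (fun j => dz ι x (e j x))
  normal : IsNormalOn S ι U ζ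
  unit : ∀ x ∈ U, ‖ζ x‖ = 1

/-- The coefficients `h_{jk} = II^ζ (Z_j, Z_k)` of the second fundamental form. -/
def secondCoeff (S : PHData (Model m) M) (ι : M → Heis n)
    (e : Fin m → ∀ x : M, TangentSpace 𝓘(ℝ, Model m) x) (ζ : M → EuclideanSpace ℂ (Fin n))
    (x : M) (j k : Fin m) : ℂ :=
  secondForm S ι ζ x (e j x) (e k x)

/-- The connection form `⟨∇ Z, W⟩` of `H_n` along `M`, for sections `Z, W : M → ℂⁿ` of
`T_{1,0} H_n`. -/
def connForm (Z W : M → EuclideanSpace ℂ (Fin n)) (x : M) :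
    TangentSpace 𝓘(ℝ, Model m) x →L[ℝ] ℂ :=
  ((innerSL ℂ (W x)).restrictScalars ℝ).comp (dvec Z x)

/-- The form `θ_j^n = ⟨∇ Z_j, ζ⟩` of a Darboux frame. -/
def mixedForm (ι : M → Heis n) (e : Fin m → ∀ x : M, TangentSpace 𝓘(ℝ, Model m) x)
    (ζ : M → EuclideanSpace ℂ (Fin n)) (j : Fin m) (x : M) :
    TangentSpace 𝓘(ℝ, Model m) x →L[ℝ] ℂ :=
  connForm (fun y => dz ι y (e j y)) ζ x

/-- The form `θ_n^n = ⟨∇ ζ, ζ⟩` of the normal connection `∇^⊥ ζ = θ_n^n ⊗ ζ`, for a unit normal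
section `ζ` in CR codimension one. -/
def normalForm (ζ : M → EuclideanSpace ℂ (Fin n)) (x : M) :
    TangentSpace 𝓘(ℝ, Model m) x →L[ℝ] ℂ :=
  connForm ζ ζ x

end Submanifold

end Pseudohermitian

end

open Pseudohermitian

/-!
Read in a chart, the `ℂⁿ`-components `f` and `g` of two vertical immersions which induce the same
structure have differentials that intertwine `J` with `i` and induce the same Hermitian form. As for
the Levi-Civita connection, the symmetry of the higher derivatives together with the `J`-linearity
then forces all Hermitian products among the derivatives of `f` of order at most two, and the
products of the third derivatives with these, to agree with those of `g`. Where the immersion is not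
flat the first and second derivatives span `ℂ^{m+1}`, so they are moving frames with the same Gram
and connection matrices, and a locally constant unitary map takes one to the other. On a connected
manifold there is thus one unitary map relating the differentials, and the common contact form
recovers the `t`-component up to a constant: the immersions differ by a rigid motion. The Gauss-like
and Codazzi-like equations are the structure equation `dθ = θ ∧ θ` of the flat connection of `H_n`
in a Darboux frame, which also exhibits the Webster connection as its tangential part.
-/

noncomputable section

namespace Pseudohermitian

open Filter Topology
open scoped ComplexConjugate

/-! ### Calculus in charts -/

section ChartCalculus

variable {E : Type*} [NormedAddCommGroup E] [NormedSpace ℝ E]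
  {F : Type*} [NormedAddCommGroup F] [NormedSpace ℝ F]
  {W : Type*} [NormedAddCommGroup W] [NormedSpace ℝ W]

theorem eventually_eq_of_eventually_hasFDerivAt_zero {f : E → F} {y : E}
    (h : ∀ᶠ z in 𝓝 y, HasFDerivAt f (0 : E →L[ℝ] F) z) : ∀ᶠ z in 𝓝 y, f z = f y := by
  obtain ⟨r, hr, hball⟩ := Metric.mem_nhds_iff.1 h
  filter_upwards [Metric.ball_mem_nhds y hr] with z hz
  exact Metric.isOpen_ball.is_const_of_fderiv_eq_zero (convex_ball y r).isPreconnected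
    (fun z hz => (hball hz).differentiableAt.differentiableWithinAt)
    (fun z hz => (hball hz).fderiv) hz (Metric.mem_ball_self hr)

/-- The second derivatives of `B` cancel by symmetry: this is `d(a ∘ dB) = da ∧ dB`. -/
theorem fderiv_clm_comp_fderiv_sub {a : E → W →L[ℝ] F} {B : E → W} {y : E}
    (ha : DifferentiableAt ℝ a y) (hB : ContDiffAt ℝ 2 B y) (v w : E) :
    fderiv ℝ (fun z => (a z).comp (fderiv ℝ B z)) y v w -
        fderiv ℝ (fun z => (a z).comp (fderiv ℝ B z)) y w v =
      fderiv ℝ a y v (fderiv ℝ B y w) - fderiv ℝ a y w (fderiv ℝ B y v) := by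
  have hB' : DifferentiableAt ℝ (fderiv ℝ B) y :=
    (hB.fderiv_right (m := 1) (by norm_num)).differentiableAt (by simp)
  have hsymm : fderiv ℝ (fderiv ℝ B) y v w = fderiv ℝ (fderiv ℝ B) y w v :=
    (hB.isSymmSndFDerivAt (by simp)).eq v w
  rw [(ha.hasFDerivAt.clm_comp hB'.hasFDerivAt).fderiv]
  simp [hsymm]

variable {M : Type*} [TopologicalSpace M] [ChartedSpace E M]

theorem tendsto_extChartAt_symm (x : M) :
    Tendsto (extChartAt 𝓘(ℝ, E) x).symm (𝓝 (extChartAt 𝓘(ℝ, E) x x)) (𝓝 x) := by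
  simpa [ContinuousAt] using continuousAt_extChartAt_symm (I := 𝓘(ℝ, E)) x

theorem extD_congr {κ κ' : ∀ x : M, TangentSpace 𝓘(ℝ, E) x →L[ℝ] F} {x : M}
    (h : ∀ᶠ x' in 𝓝 x, κ x' = κ' x') : extD κ x = extD κ' x := by
  have hchart : formInChart κ x =ᶠ[𝓝 (extChartAt 𝓘(ℝ, E) x x)] formInChart κ' x := by
    filter_upwards [(tendsto_extChartAt_symm x).eventually h] with y hy
    simp only [formInChart, hy]
  funext v w
  simp only [extD, hchart.fderiv_eq]

theorem fderiv_comp_extChartAt_symm_self {B : M → W} {x : M}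
    (hB : MDifferentiableAt 𝓘(ℝ, E) 𝓘(ℝ, W) B x) :
    fderiv ℝ (B ∘ (extChartAt 𝓘(ℝ, E) x).symm) (extChartAt 𝓘(ℝ, E) x x) =
      mfderiv 𝓘(ℝ, E) 𝓘(ℝ, W) B x := by
  rw [hB.mfderiv]
  simp only [mfld_simps, fderivWithin_univ]
  rfl

variable [IsManifold 𝓘(ℝ, E) ∞ M]

theorem contMDiffAt_extChartAt_symm {x₀ : M} {y : E} (hy : y ∈ (extChartAt 𝓘(ℝ, E) x₀).target) :
    ContMDiffAt 𝓘(ℝ, E) 𝓘(ℝ, E) ∞ (extChartAt 𝓘(ℝ, E) x₀).symm y :=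
  (contMDiffOn_extChartAt_symm x₀).contMDiffAt ((isOpen_extChartAt_target x₀).mem_nhds hy)

theorem mdifferentiableAt_extChartAt_symm {x₀ : M} {y : E}
    (hy : y ∈ (extChartAt 𝓘(ℝ, E) x₀).target) :
    MDifferentiableAt 𝓘(ℝ, E) 𝓘(ℝ, E) (extChartAt 𝓘(ℝ, E) x₀).symm y :=
  (contMDiffAt_extChartAt_symm hy).mdifferentiableAt (by simp)

theorem mfderiv_extChartAt_symm_mfderiv_extChartAt {x₀ : M} {y : E}
    (hy : y ∈ (extChartAt 𝓘(ℝ, E) x₀).target)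
    (v : TangentSpace 𝓘(ℝ, E) ((extChartAt 𝓘(ℝ, E) x₀).symm y)) :
    mfderiv 𝓘(ℝ, E) 𝓘(ℝ, E) (extChartAt 𝓘(ℝ, E) x₀).symm y
      (mfderiv 𝓘(ℝ, E) 𝓘(ℝ, E) (extChartAt 𝓘(ℝ, E) x₀) ((extChartAt 𝓘(ℝ, E) x₀).symm y) v) = v := by
  have hinv := mfderivWithin_extChartAt_symm_comp_mfderiv_extChartAt hy
  rw [ModelWithCorners.range_eq_univ, mfderivWithin_univ] at hinv
  exact DFunLike.congr_fun hinv v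

theorem contDiffAt_comp_extChartAt_symm {B : M → W} {x₀ : M} {y : E} {n : WithTop ℕ∞}
    (hn : n ≤ ∞) (hy : y ∈ (extChartAt 𝓘(ℝ, E) x₀).target)
    (hB : ContMDiffAt 𝓘(ℝ, E) 𝓘(ℝ, W) n B ((extChartAt 𝓘(ℝ, E) x₀).symm y)) :
    ContDiffAt ℝ n (B ∘ (extChartAt 𝓘(ℝ, E) x₀).symm) y := by
  rw [← contMDiffAt_iff_contDiffAt]
  exact hB.comp y ((contMDiffAt_extChartAt_symm hy).of_le hn)

theorem differentiableAt_comp_extChartAt_symm {B : M → W} {x₀ : M} {y : E}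
    (hy : y ∈ (extChartAt 𝓘(ℝ, E) x₀).target)
    (hB : MDifferentiableAt 𝓘(ℝ, E) 𝓘(ℝ, W) B ((extChartAt 𝓘(ℝ, E) x₀).symm y)) :
    DifferentiableAt ℝ (B ∘ (extChartAt 𝓘(ℝ, E) x₀).symm) y := by
  rw [← mdifferentiableAt_iff_differentiableAt]
  exact hB.comp y (mdifferentiableAt_extChartAt_symm hy)

theorem fderiv_comp_extChartAt_symm {B : M → W} {x₀ : M} {y : E}
    (hy : y ∈ (extChartAt 𝓘(ℝ, E) x₀).target)
    (hB : MDifferentiableAt 𝓘(ℝ, E) 𝓘(ℝ, W) B ((extChartAt 𝓘(ℝ, E) x₀).symm y)) :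
    fderiv ℝ (B ∘ (extChartAt 𝓘(ℝ, E) x₀).symm) y =
      (mfderiv 𝓘(ℝ, E) 𝓘(ℝ, W) B ((extChartAt 𝓘(ℝ, E) x₀).symm y)).comp
        (mfderiv 𝓘(ℝ, E) 𝓘(ℝ, E) (extChartAt 𝓘(ℝ, E) x₀).symm y) := by
  rw [← mfderiv_eq_fderiv]
  exact mfderiv_comp y hB (mdifferentiableAt_extChartAt_symm hy)

theorem formInChart_comp_mfderiv (a : M → W →L[ℝ] F) {B : M → W} {x₀ : M} {y : E}
    (hy : y ∈ (extChartAt 𝓘(ℝ, E) x₀).target)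
    (hB : MDifferentiableAt 𝓘(ℝ, E) 𝓘(ℝ, W) B ((extChartAt 𝓘(ℝ, E) x₀).symm y)) :
    formInChart (fun x => (a x).comp (mfderiv 𝓘(ℝ, E) 𝓘(ℝ, W) B x)) x₀ y =
      (a ((extChartAt 𝓘(ℝ, E) x₀).symm y)).comp
        (fderiv ℝ (B ∘ (extChartAt 𝓘(ℝ, E) x₀).symm) y) := by
  rw [fderiv_comp_extChartAt_symm hy hB]
  rfl

theorem smoothFormOn_comp_mfderiv {U : Set M} (hU : IsOpen U) {a : M → W →L[ℝ] F} {B : M → W}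
    (ha : ContMDiffOn 𝓘(ℝ, E) 𝓘(ℝ, W →L[ℝ] F) ∞ a U)
    (hB : ContMDiffOn 𝓘(ℝ, E) 𝓘(ℝ, W) ∞ B U) :
    SmoothFormOn (fun x => (a x).comp (mfderiv 𝓘(ℝ, E) 𝓘(ℝ, W) B x)) U := by
  intro x₀
  have hsmooth : ContDiffOn ℝ ∞ (fun y => (a ((extChartAt 𝓘(ℝ, E) x₀).symm y)).comp
        (fderiv ℝ (B ∘ (extChartAt 𝓘(ℝ, E) x₀).symm) y))
      ((extChartAt 𝓘(ℝ, E) x₀).target ∩ (extChartAt 𝓘(ℝ, E) x₀).symm ⁻¹' U) := by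
    rintro y ⟨hy, hyU⟩
    have hac := contDiffAt_comp_extChartAt_symm le_rfl hy (ha.contMDiffAt (hU.mem_nhds hyU))
    have hBc := contDiffAt_comp_extChartAt_symm le_rfl hy (hB.contMDiffAt (hU.mem_nhds hyU))
    exact (ContDiffAt.clm_comp hac (hBc.fderiv_right (m := ∞) (by simp))).contDiffWithinAt
  refine hsmooth.congr ?_
  rintro y ⟨hy, hyU⟩
  exact formInChart_comp_mfderiv a hy
    ((hB.contMDiffAt (hU.mem_nhds hyU)).mdifferentiableAt (by simp))

theorem extD_comp_mfderiv {a : M → W →L[ℝ] F} {B : M → W} {x : M}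
    (ha : MDifferentiableAt 𝓘(ℝ, E) 𝓘(ℝ, W →L[ℝ] F) a x)
    (hB : ContMDiffAt 𝓘(ℝ, E) 𝓘(ℝ, W) 2 B x) (v w : TangentSpace 𝓘(ℝ, E) x) :
    extD (fun x => (a x).comp (mfderiv 𝓘(ℝ, E) 𝓘(ℝ, W) B x)) x v w =
      (show W →L[ℝ] F from mfderiv 𝓘(ℝ, E) 𝓘(ℝ, W →L[ℝ] F) a x v)
          (mfderiv 𝓘(ℝ, E) 𝓘(ℝ, W) B x w) -
        (show W →L[ℝ] F from mfderiv 𝓘(ℝ, E) 𝓘(ℝ, W →L[ℝ] F) a x w)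
          (mfderiv 𝓘(ℝ, E) 𝓘(ℝ, W) B x v) := by
  set c := extChartAt 𝓘(ℝ, E) x with hc
  have hct : c x ∈ c.target := mem_extChartAt_target x
  have hcx : c.symm (c x) = x := extChartAt_to_inv x
  have hB_near : ∀ᶠ x' in 𝓝 x, MDifferentiableAt 𝓘(ℝ, E) 𝓘(ℝ, W) B x' := by
    filter_upwards [(contMDiffAt_iff_contMDiffAt_nhds (by decide)).1 hB] with x' hx'
    exact hx'.mdifferentiableAt (by simp)
  have hform : formInChart (fun x => (a x).comp (mfderiv 𝓘(ℝ, E) 𝓘(ℝ, W) B x)) x =ᶠ[𝓝 (c x)]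
      fun y => ((a ∘ c.symm) y).comp (fderiv ℝ (B ∘ c.symm) y) := by
    filter_upwards [(tendsto_extChartAt_symm x).eventually hB_near,
      extChartAt_target_mem_nhds x] with y hy hy'
    exact formInChart_comp_mfderiv a hy' hy
  have hBc : ContDiffAt ℝ 2 (B ∘ c.symm) (c x) :=
    contDiffAt_comp_extChartAt_symm ENat.LEInfty.out hct (by rwa [← hc, hcx])
  have hac : DifferentiableAt ℝ (a ∘ c.symm) (c x) :=
    differentiableAt_comp_extChartAt_symm hct (by rwa [← hc, hcx])
  simp only [extD]
  rw [← hc, hform.fderiv_eq, ← fderiv_comp_extChartAt_symm_self ha,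
    ← fderiv_comp_extChartAt_symm_self (hB.mdifferentiableAt (by simp))]
  exact fderiv_clm_comp_fderiv_sub hac hBc v w

theorem eq_of_mfderiv_eq_zero [PreconnectedSpace M] {f : M → W}
    (hf : ∀ x, MDifferentiableAt 𝓘(ℝ, E) 𝓘(ℝ, W) f x)
    (h : ∀ x, mfderiv 𝓘(ℝ, E) 𝓘(ℝ, W) f x = 0) (x y : M) : f x = f y := by
  refine IsLocallyConstant.apply_eq_of_preconnectedSpace ?_ x y
  rw [IsLocallyConstant.iff_eventually_eq]
  intro x
  set c := extChartAt 𝓘(ℝ, E) x with hc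
  have hconst : ∀ᶠ y in 𝓝 (c x), (f ∘ c.symm) y = (f ∘ c.symm) (c x) := by
    apply eventually_eq_of_eventually_hasFDerivAt_zero
    filter_upwards [extChartAt_target_mem_nhds x] with y hy
    refine (differentiableAt_comp_extChartAt_symm hy (hf _)).hasFDerivAt.congr_fderiv ?_
    rw [fderiv_comp_extChartAt_symm hy (hf _), h]
    exact ContinuousLinearMap.zero_comp _
  filter_upwards [(continuousAt_extChartAt x).eventually hconst,
    extChartAt_source_mem_nhds (I := 𝓘(ℝ, E)) x] with x' hx' hx's
  calc f x' = f (c.symm (c x')) := by rw [c.left_inv hx's]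
    _ = f (c.symm (c x)) := hx'
    _ = f x := by rw [hc, extChartAt_to_inv]

end ChartCalculus

/-! ### Local rigidity of isometric pairs of `J`-holomorphic maps -/

section SkewTensors

variable {E X : Type*}

/-- Replacing `r` by `J r` multiplies `T r a b` by `-i`, but the conjugate on the other side of the
skew symmetry by `i`. -/
theorem eq_zero_of_conjLinear_of_skewHermitian {T : E → X → X → ℂ} {J : E → E}
    (hJ : ∀ r a b, T (J r) a b = -Complex.I * T r a b) (hskew : ∀ r a b, T r a b = -conj (T r b a))
    (r : E) (a b : X) : T r a b = 0 := by
  have hleft : T (J r) a b = -Complex.I * T r a b := hJ r a b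
  have hright : T (J r) a b = Complex.I * T r a b := by
    rw [hskew, hJ, hskew r a b, map_mul, map_neg, Complex.conj_I]
    ring
  have hI : Complex.I * T r a b = 0 := by linear_combination (hleft - hright) / 2
  simpa using hI

theorem eq_zero_of_symm_of_skewHermitian {T : E → E → E → ℂ} {J : E → E}
    (hsymm : ∀ u v w, T u v w = T v u w) (hskew : ∀ u v w, T u v w = -conj (T u w v))
    (hJ : ∀ u v w, T u v (J w) = Complex.I * T u v w) (u v w : E) : T u v w = 0 := by
  refine eq_zero_of_conjLinear_of_skewHermitian (J := J) (fun u v w => ?_) hskew u v w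
  rw [hsymm, hskew, hJ, hsymm u, hskew v u, map_mul, Complex.conj_I]
  ring

/-- The symmetries move `u` from the conjugate-linear pair into the linear one. -/
theorem eq_zero_of_symm_of_sesquilinear {T : E → E → E → E → ℂ} {J : E → E}
    (hsymm_left : ∀ u v s w, T u v s w = T v u s w) (hsymm_right : ∀ u v s w, T u v s w = T u v w s)
    (hswap : ∀ u v s w, T u v s w = T s v u w)
    (hJ_left : ∀ u v s w, T u (J v) s w = -Complex.I * T u v s w)
    (hJ_right : ∀ u v s w, T u v s (J w) = Complex.I * T u v s w) (u v s w : E) :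
    T u v s w = 0 := by
  have hleft : T (J u) v s w = -Complex.I * T u v s w := by rw [hsymm_left, hJ_left, hsymm_left]
  have hright : T (J u) v s w = Complex.I * T u v s w := by
    rw [hswap, hsymm_right, hJ_right, hsymm_right, hswap]
  have hI : Complex.I * T u v s w = 0 := by linear_combination (hleft - hright) / 2
  simpa using hI

end SkewTensors

local notation "𝐃" => fderiv ℝ

section Derivatives

variable {E : Type*} [NormedAddCommGroup E] [NormedSpace ℝ E]
  {G : Type*} [NormedAddCommGroup G] [NormedSpace ℝ G]
  {H : Type*} [NormedAddCommGroup H] [NormedSpace ℝ H]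
  {V : Type*} [NormedAddCommGroup V] [InnerProductSpace ℂ V]
  {V' : Type*} [NormedAddCommGroup V'] [InnerProductSpace ℂ V']

theorem contDiffAt_fderiv {f : E → G} {y : E} (h : ContDiffAt ℝ ∞ f y) :
    ContDiffAt ℝ ∞ (𝐃 f) y :=
  h.fderiv_right (m := ∞) (by simp)

theorem hasFDerivAt_of_contDiffAt {f : E → G} {y : E} (h : ContDiffAt ℝ ∞ f y) :
    HasFDerivAt f (𝐃 f y) y :=
  (h.differentiableAt (by simp)).hasFDerivAt

theorem hasFDerivAt_clm_apply_const {a : E → H →L[ℝ] G} {a' : E →L[ℝ] H →L[ℝ] G} {y : E}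
    (h : HasFDerivAt a a' y) (v : H) : HasFDerivAt (fun z => a z v) (a'.flip v) y := by
  simpa using h.clm_apply (hasFDerivAt_const v y)

theorem hasFDerivAt_fderiv_apply {f : E → G} {y : E} (h : ContDiffAt ℝ ∞ f y) (v : E) :
    HasFDerivAt (fun z => 𝐃 f z v) ((𝐃 (𝐃 f) y).flip v) y :=
  hasFDerivAt_clm_apply_const (hasFDerivAt_of_contDiffAt (contDiffAt_fderiv h)) v

theorem hasFDerivAt_fderiv_fderiv_apply {f : E → G} {y : E} (h : ContDiffAt ℝ ∞ f y) (u v : E) :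
    HasFDerivAt (fun z => 𝐃 (𝐃 f) z u v) (((𝐃 (𝐃 (𝐃 f)) y).flip u).flip v) y :=
  hasFDerivAt_clm_apply_const (hasFDerivAt_fderiv_apply (contDiffAt_fderiv h) u) v

theorem fderiv_fderiv_comm {f : E → G} {y : E} (h : ContDiffAt ℝ ∞ f y) (u v : E) :
    𝐃 (𝐃 f) y u v = 𝐃 (𝐃 f) y v u :=
  (h.isSymmSndFDerivAt (by simpa using ENat.LEInfty.out)).eq u v

theorem fderiv_fderiv_fderiv_comm_left {f : E → G} {y : E} (h : ContDiffAt ℝ ∞ f y) (r u v : E) :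
    𝐃 (𝐃 (𝐃 f)) y r u v = 𝐃 (𝐃 (𝐃 f)) y u r v := by
  rw [fderiv_fderiv_comm (contDiffAt_fderiv h) r u]

theorem inner_add_inner_of_eventuallyEq {a b : E → V} {a' b' : E → V'} {da db : E →L[ℝ] V}
    {da' db' : E →L[ℝ] V'} {y : E}
    (h : ∀ᶠ z in 𝓝 y, inner ℂ (a z) (b z) = inner ℂ (a' z) (b' z))
    (ha : HasFDerivAt a da y) (hb : HasFDerivAt b db y)
    (ha' : HasFDerivAt a' da' y) (hb' : HasFDerivAt b' db' y) (s : E) :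
    inner ℂ (a y) (db s) + inner ℂ (da s) (b y) =
      inner ℂ (a' y) (db' s) + inner ℂ (da' s) (b' y) := by
  have hleft := ha.inner ℂ hb
  have hright := (ha'.inner ℂ hb').congr_of_eventuallyEq h
  simpa only [ContinuousLinearMap.comp_apply, ContinuousLinearMap.prod_apply,
    fderivInnerCLM_apply] using DFunLike.congr_fun (hleft.unique hright) s

end Derivatives

section LocalRigidity

variable {E : Type*} [NormedAddCommGroup E] [NormedSpace ℝ E] {Ω : Set E} {J : E → E →L[ℝ] E}
  {y : E}

/-- `f` is a smooth map on the open set `Ω` whose differential intertwines the smooth field of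
endomorphisms `J` with the multiplication by `i`. Nothing is required of `J ^ 2`: the `J` of a
pseudohermitian structure has a kernel. -/
structure IsJHolomorphicOn {V : Type*} [NormedAddCommGroup V] [NormedSpace ℂ V] (Ω : Set E)
    (J : E → E →L[ℝ] E) (f : E → V) : Prop where
  isOpen : IsOpen Ω
  smooth : ContDiffOn ℝ ∞ f Ω
  smooth_J : ContDiffOn ℝ ∞ J Ω
  fderiv_J : ∀ y ∈ Ω, ∀ v, 𝐃 f y (J y v) = Complex.I • 𝐃 f y v

namespace IsJHolomorphicOn

variable {V : Type*} [NormedAddCommGroup V] [NormedSpace ℂ V] {f : E → V}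

theorem contDiffAt (hf : IsJHolomorphicOn Ω J f) (hy : y ∈ Ω) : ContDiffAt ℝ ∞ f y :=
  hf.smooth.contDiffAt (hf.isOpen.mem_nhds hy)

theorem contDiffAt_J (hf : IsJHolomorphicOn Ω J f) (hy : y ∈ Ω) : ContDiffAt ℝ ∞ J y :=
  hf.smooth_J.contDiffAt (hf.isOpen.mem_nhds hy)

theorem fderiv_fderiv_fderiv_comm_right (hf : IsJHolomorphicOn Ω J f) (hy : y ∈ Ω) (r u v : E) :
    𝐃 (𝐃 (𝐃 f)) y r u v = 𝐃 (𝐃 (𝐃 f)) y r v u := by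
  have huv := hasFDerivAt_fderiv_fderiv_apply (hf.contDiffAt hy) u v
  have hvu : HasFDerivAt (fun z => 𝐃 (𝐃 f) z u v) (((𝐃 (𝐃 (𝐃 f)) y).flip v).flip u) y := by
    refine (hasFDerivAt_fderiv_fderiv_apply (hf.contDiffAt hy) v u).congr_of_eventuallyEq ?_
    filter_upwards [hf.isOpen.mem_nhds hy] with z hz
    exact fderiv_fderiv_comm (hf.contDiffAt hz) u v
  exact DFunLike.congr_fun (huv.unique hvu) r

theorem fderiv_fderiv_J (hf : IsJHolomorphicOn Ω J f) (hy : y ∈ Ω) (u v : E) :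
    𝐃 (𝐃 f) y u (J y v) = Complex.I • 𝐃 (𝐃 f) y u v - 𝐃 f y (𝐃 J y u v) := by
  have hfJ := (hasFDerivAt_of_contDiffAt (contDiffAt_fderiv (hf.contDiffAt hy))).clm_apply
    (hasFDerivAt_clm_apply_const (hasFDerivAt_of_contDiffAt (hf.contDiffAt_J hy)) v)
  have hIf : HasFDerivAt (fun z => 𝐃 f z (J z v)) (Complex.I • (𝐃 (𝐃 f) y).flip v) y := by
    refine ((hasFDerivAt_fderiv_apply (hf.contDiffAt hy) v).const_smul
      Complex.I).congr_of_eventuallyEq ?_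
    filter_upwards [hf.isOpen.mem_nhds hy] with z hz using hf.fderiv_J z hz v
  rw [eq_sub_iff_add_eq, add_comm]
  simpa using DFunLike.congr_fun (hfJ.unique hIf) u

theorem fderiv_fderiv_fderiv_J (hf : IsJHolomorphicOn Ω J f) (hy : y ∈ Ω) (r u v : E) :
    𝐃 (𝐃 (𝐃 f)) y r u (J y v) = Complex.I • 𝐃 (𝐃 (𝐃 f)) y r u v - 𝐃 (𝐃 f) y u (𝐃 J y r v) -
      𝐃 (𝐃 f) y r (𝐃 J y u v) - 𝐃 f y (𝐃 (𝐃 J) y r u v) := by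
  have hf' := contDiffAt_fderiv (hf.contDiffAt hy)
  have hsum := ((hasFDerivAt_fderiv_apply hf' u).clm_apply
    (hasFDerivAt_clm_apply_const (hasFDerivAt_of_contDiffAt (hf.contDiffAt_J hy)) v)).add
    ((hasFDerivAt_of_contDiffAt hf').clm_apply
      (hasFDerivAt_clm_apply_const (hasFDerivAt_fderiv_apply (hf.contDiffAt_J hy) u) v))
  have hIf : HasFDerivAt (fun z => 𝐃 (𝐃 f) z u (J z v) + 𝐃 f z (𝐃 J z u v))
      (Complex.I • ((𝐃 (𝐃 (𝐃 f)) y).flip u).flip v) y := by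
    refine ((hasFDerivAt_fderiv_fderiv_apply (hf.contDiffAt hy) u v).const_smul
      Complex.I).congr_of_eventuallyEq ?_
    filter_upwards [hf.isOpen.mem_nhds hy] with z hz
    rw [hf.fderiv_fderiv_J hz, sub_add_cancel]
    rfl
  have hval := DFunLike.congr_fun (hsum.unique hIf) r
  simp only [add_apply, ContinuousLinearMap.comp_apply,
    ContinuousLinearMap.flip_apply, smul_apply] at hval
  rw [← hval]
  abel

end IsJHolomorphicOn

/-- Two `J`-holomorphic maps which induce the same Hermitian form on `Ω`: two vertical immersions of
one pseudohermitian manifold, read in a chart. -/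
structure IsIsometricPairOn {V V' : Type*} [NormedAddCommGroup V] [InnerProductSpace ℂ V]
    [NormedAddCommGroup V'] [InnerProductSpace ℂ V'] (Ω : Set E) (J : E → E →L[ℝ] E)
    (f : E → V) (g : E → V') : Prop where
  left : IsJHolomorphicOn Ω J f
  right : IsJHolomorphicOn Ω J g
  inner_fderiv : ∀ y ∈ Ω, ∀ v w, inner ℂ (𝐃 f y v) (𝐃 f y w) = inner ℂ (𝐃 g y v) (𝐃 g y w)

namespace IsIsometricPairOn

variable {V V' : Type*} [NormedAddCommGroup V] [InnerProductSpace ℂ V]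
  [NormedAddCommGroup V'] [InnerProductSpace ℂ V'] {f : E → V} {g : E → V'}

theorem inner_fderiv2_fderiv (h : IsIsometricPairOn Ω J f g) (hy : y ∈ Ω) (u v w : E) :
    inner ℂ (𝐃 (𝐃 f) y u v) (𝐃 f y w) = inner ℂ (𝐃 (𝐃 g) y u v) (𝐃 g y w) := by
  let T : E → E → E → ℂ := fun u v w =>
    inner ℂ (𝐃 (𝐃 f) y u v) (𝐃 f y w) - inner ℂ (𝐃 (𝐃 g) y u v) (𝐃 g y w)
  suffices T u v w = 0 from sub_eq_zero.1 this
  refine eq_zero_of_symm_of_skewHermitian (J := J y) (fun u v w => ?_) (fun u v w => ?_)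
    (fun u v w => ?_) u v w
  · simp only [T, fderiv_fderiv_comm (h.left.contDiffAt hy) u v,
      fderiv_fderiv_comm (h.right.contDiffAt hy) u v]
  · have hprod := inner_add_inner_of_eventuallyEq
      (by filter_upwards [h.left.isOpen.mem_nhds hy] with z hz using h.inner_fderiv z hz v w)
      (hasFDerivAt_fderiv_apply (h.left.contDiffAt hy) v)
      (hasFDerivAt_fderiv_apply (h.left.contDiffAt hy) w)
      (hasFDerivAt_fderiv_apply (h.right.contDiffAt hy) v)
      (hasFDerivAt_fderiv_apply (h.right.contDiffAt hy) w) u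
    simp only [ContinuousLinearMap.flip_apply] at hprod
    simp only [T, map_sub, inner_conj_symm]
    linear_combination hprod
  · simp only [T, h.left.fderiv_J y hy, h.right.fderiv_J y hy, inner_smul_right]
    ring

theorem inner_fderiv_fderiv2 (h : IsIsometricPairOn Ω J f g) (hy : y ∈ Ω) (u v w : E) :
    inner ℂ (𝐃 f y w) (𝐃 (𝐃 f) y u v) = inner ℂ (𝐃 g y w) (𝐃 (𝐃 g) y u v) := by
  rw [← inner_conj_symm, h.inner_fderiv2_fderiv hy, inner_conj_symm]

theorem inner_fderiv2_fderiv2_add_inner_fderiv3_fderiv (h : IsIsometricPairOn Ω J f g)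
    (hy : y ∈ Ω) (r u v w : E) :
    inner ℂ (𝐃 (𝐃 f) y u v) (𝐃 (𝐃 f) y r w) + inner ℂ (𝐃 (𝐃 (𝐃 f)) y r u v) (𝐃 f y w) =
      inner ℂ (𝐃 (𝐃 g) y u v) (𝐃 (𝐃 g) y r w) + inner ℂ (𝐃 (𝐃 (𝐃 g)) y r u v) (𝐃 g y w) := by
  simpa only [ContinuousLinearMap.flip_apply] using inner_add_inner_of_eventuallyEq
    (by filter_upwards [h.left.isOpen.mem_nhds hy] with z hz using h.inner_fderiv2_fderiv hz u v w)
    (hasFDerivAt_fderiv_fderiv_apply (h.left.contDiffAt hy) u v)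
    (hasFDerivAt_fderiv_apply (h.left.contDiffAt hy) w)
    (hasFDerivAt_fderiv_fderiv_apply (h.right.contDiffAt hy) u v)
    (hasFDerivAt_fderiv_apply (h.right.contDiffAt hy) w) r

/-- The difference of the two sides is the difference of the curvatures of `f` and `g`. -/
theorem inner_fderiv2_fderiv2 (h : IsIsometricPairOn Ω J f g) (hy : y ∈ Ω) (u v s w : E) :
    inner ℂ (𝐃 (𝐃 f) y u v) (𝐃 (𝐃 f) y s w) = inner ℂ (𝐃 (𝐃 g) y u v) (𝐃 (𝐃 g) y s w) := by
  let T : E → E → E → E → ℂ := fun u v s w =>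
    inner ℂ (𝐃 (𝐃 f) y u v) (𝐃 (𝐃 f) y s w) - inner ℂ (𝐃 (𝐃 g) y u v) (𝐃 (𝐃 g) y s w)
  suffices T u v s w = 0 from sub_eq_zero.1 this
  refine eq_zero_of_symm_of_sesquilinear (J := J y) (fun u v s w => ?_) (fun u v s w => ?_)
    (fun u v s w => ?_) (fun u v s w => ?_) (fun u v s w => ?_) u v s w
  · simp only [T, fderiv_fderiv_comm (h.left.contDiffAt hy) u v,
      fderiv_fderiv_comm (h.right.contDiffAt hy) u v]
  · simp only [T, fderiv_fderiv_comm (h.left.contDiffAt hy) s w,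
      fderiv_fderiv_comm (h.right.contDiffAt hy) s w]
  · have hsu := h.inner_fderiv2_fderiv2_add_inner_fderiv3_fderiv hy s u v w
    have hus := h.inner_fderiv2_fderiv2_add_inner_fderiv3_fderiv hy u s v w
    rw [fderiv_fderiv_fderiv_comm_left (h.left.contDiffAt hy) u s v,
      fderiv_fderiv_fderiv_comm_left (h.right.contDiffAt hy) u s v] at hus
    simp only [T]
    linear_combination hsu - hus
  · simp only [T, h.left.fderiv_fderiv_J hy, h.right.fderiv_fderiv_J hy, inner_sub_left,
      inner_smul_left, h.inner_fderiv_fderiv2 hy, Complex.conj_I]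
    ring
  · simp only [T, h.left.fderiv_fderiv_J hy, h.right.fderiv_fderiv_J hy, inner_sub_right,
      inner_smul_right, h.inner_fderiv2_fderiv hy]
    ring

theorem inner_fderiv3_fderiv (h : IsIsometricPairOn Ω J f g) (hy : y ∈ Ω) (r u v w : E) :
    inner ℂ (𝐃 (𝐃 (𝐃 f)) y r u v) (𝐃 f y w) = inner ℂ (𝐃 (𝐃 (𝐃 g)) y r u v) (𝐃 g y w) := by
  have hsum := h.inner_fderiv2_fderiv2_add_inner_fderiv3_fderiv hy r u v w
  rwa [h.inner_fderiv2_fderiv2 hy, add_right_inj] at hsum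

theorem inner_fderiv3_fderiv2 (h : IsIsometricPairOn Ω J f g) (hy : y ∈ Ω) (r u v s w : E) :
    inner ℂ (𝐃 (𝐃 (𝐃 f)) y r u v) (𝐃 (𝐃 f) y s w) =
      inner ℂ (𝐃 (𝐃 (𝐃 g)) y r u v) (𝐃 (𝐃 g) y s w) := by
  let T : E → E × E → E × E → ℂ := fun r a b =>
    inner ℂ (𝐃 (𝐃 (𝐃 f)) y r a.1 a.2) (𝐃 (𝐃 f) y b.1 b.2) -
      inner ℂ (𝐃 (𝐃 (𝐃 g)) y r a.1 a.2) (𝐃 (𝐃 g) y b.1 b.2)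
  have hreverse : ∀ r u v b, T r (u, v) b = T v (u, r) b := fun r u v b => by
    simp only [T]
    rw [h.left.fderiv_fderiv_fderiv_comm_right hy r u v,
      h.right.fderiv_fderiv_fderiv_comm_right hy r u v,
      fderiv_fderiv_fderiv_comm_left (h.left.contDiffAt hy) r v u,
      fderiv_fderiv_fderiv_comm_left (h.right.contDiffAt hy) r v u,
      h.left.fderiv_fderiv_fderiv_comm_right hy v r u,
      h.right.fderiv_fderiv_fderiv_comm_right hy v r u]
  have hJ_last : ∀ r u v b, T r (u, J y v) b = -Complex.I * T r (u, v) b := fun r u v b => by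
    simp only [T, h.left.fderiv_fderiv_fderiv_J hy, h.right.fderiv_fderiv_fderiv_J hy,
      inner_sub_left, inner_smul_left, h.inner_fderiv_fderiv2 hy, h.inner_fderiv2_fderiv2 hy,
      Complex.conj_I]
    ring
  have hskew : ∀ r a b, T r a b = -conj (T r b a) := fun r a b => by
    have hprod := inner_add_inner_of_eventuallyEq
      (by filter_upwards [h.left.isOpen.mem_nhds hy] with z hz
            using h.inner_fderiv2_fderiv2 hz a.1 a.2 b.1 b.2)
      (hasFDerivAt_fderiv_fderiv_apply (h.left.contDiffAt hy) a.1 a.2)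
      (hasFDerivAt_fderiv_fderiv_apply (h.left.contDiffAt hy) b.1 b.2)
      (hasFDerivAt_fderiv_fderiv_apply (h.right.contDiffAt hy) a.1 a.2)
      (hasFDerivAt_fderiv_fderiv_apply (h.right.contDiffAt hy) b.1 b.2) r
    simp only [ContinuousLinearMap.flip_apply] at hprod
    simp only [T, map_sub, inner_conj_symm]
    linear_combination hprod
  have hJ_first : ∀ r a b, T (J y r) a b = -Complex.I * T r a b := fun r a b => by
    rw [hreverse, hJ_last, ← hreverse]
  exact sub_eq_zero.1 (eq_zero_of_conjLinear_of_skewHermitian hJ_first hskew r (u, v) (s, w))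

end IsIsometricPairOn

end LocalRigidity

/-! ### Moving frames -/

section MovingFrame

variable {E : Type*} [NormedAddCommGroup E] [NormedSpace ℝ E]
  {V : Type*} [NormedAddCommGroup V] [InnerProductSpace ℂ V]
  {V' : Type*} [NormedAddCommGroup V'] [InnerProductSpace ℂ V'] {ι : Type*}

theorem exists_linearIsometry_of_gram_eq {w : ι → V} {w' : ι → V'}
    (hw : Submodule.span ℂ (Set.range w) = ⊤)
    (h : ∀ k l, inner ℂ (w k) (w l) = inner ℂ (w' k) (w' l)) :
    ∃ U : V →ₗᵢ[ℂ] V', ∀ k, U (w k) = w' k := by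
  set L := Finsupp.linearCombination ℂ w
  set L' := Finsupp.linearCombination ℂ w'
  have hinner : ∀ c d, inner ℂ (L c) (L d) = inner ℂ (L' c) (L' d) := fun c d => by
    simp only [L, L', Finsupp.linearCombination_apply, Finsupp.sum_inner, Finsupp.inner_sum,
      inner_smul_left, inner_smul_right, h]
  have hnorm : ∀ c, ‖L c‖ = ‖L' c‖ := fun c => by
    rw [@norm_eq_sqrt_re_inner ℂ, @norm_eq_sqrt_re_inner ℂ, hinner]
  obtain ⟨R, hR⟩ := L.exists_rightInverse_of_surjective
    ((Finsupp.range_linearCombination ℂ).trans hw)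
  have hLR : ∀ x, L (R x) = x := DFunLike.congr_fun hR
  refine ⟨⟨L' ∘ₗ R, fun x => ?_⟩, fun k => ?_⟩
  · rw [LinearMap.comp_apply, ← hnorm, hLR]
  · have hker : ‖L' (R (w k) - Finsupp.single k 1)‖ = 0 := by
      rw [← hnorm, map_sub, hLR, Finsupp.linearCombination_single, one_smul, sub_self, norm_zero]
    rw [norm_eq_zero, map_sub, Finsupp.linearCombination_single, one_smul, sub_eq_zero] at hker
    exact hker

theorem eq_of_forall_inner_eq {w : ι → V} (hw : Submodule.span ℂ (Set.range w) = ⊤) {x y : V}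
    (h : ∀ k, inner ℂ x (w k) = inner ℂ y (w k)) : x = y :=
  ext_inner_right ℂ fun v => DFunLike.congr_fun
    (LinearMap.ext_on_range (f := innerₛₗ ℂ x) (g := innerₛₗ ℂ y) hw h) v

theorem span_range_eq_top_of_linearIsometry [FiniteDimensional ℂ V] {U : V →ₗᵢ[ℂ] V}
    {w w' : ι → V} (hw : Submodule.span ℂ (Set.range w) = ⊤) (hU : ∀ k, U (w k) = w' k) :
    Submodule.span ℂ (Set.range w') = ⊤ := by
  have hrange : Set.range w' = U.toLinearMap '' Set.range w := by
    rw [← Set.range_comp]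
    exact congrArg Set.range (funext fun k => (hU k).symm)
  rw [hrange, ← Submodule.map_span, hw, Submodule.map_top, LinearMap.range_eq_top]
  exact LinearMap.surjective_of_injective U.injective

theorem differentiableAt_linearCombination_comp [FiniteDimensional ℂ V] {w : E → ι → V'} {z : E}
    (hw : ∀ k, DifferentiableAt ℝ (fun z => w z k) z) (R : V →ₗ[ℂ] ι →₀ ℂ) :
    DifferentiableAt ℝ (fun z =>
      LinearMap.toContinuousLinearMap (Finsupp.linearCombination ℂ (w z) ∘ₗ R)) z := by
  let b := Module.finBasis ℂ V
  have hsum : ∀ z, LinearMap.toContinuousLinearMap (Finsupp.linearCombination ℂ (w z) ∘ₗ R) =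
      ∑ i, ContinuousLinearMap.smulRightL ℂ V V' (LinearMap.toContinuousLinearMap (b.coord i))
        (Finsupp.linearCombination ℂ (w z) (R (b i))) := fun z =>
    ContinuousLinearMap.coe_injective (b.ext fun j => by simp [Finsupp.single_apply, ite_smul])
  simp only [hsum, Finsupp.linearCombination_apply, Finsupp.sum]
  refine DifferentiableAt.fun_sum fun i _ => ?_
  exact ((ContinuousLinearMap.smulRightL ℂ V V' _).restrictScalars ℝ).differentiableAt.comp z
    (DifferentiableAt.fun_sum fun k _ => (hw k).const_smul (R (b i) k))

/-- With `R` a right inverse of the synthesis map of `w y`, the operators `x ↦ ∑ (R x)_k w_k` and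
`x ↦ ∑ (R x)_k w'_k` depend differentiably on the point and the first one is the identity at `y`;
the transition is their quotient. -/
theorem exists_differentiable_transition [FiniteDimensional ℂ V] {w w' : E → ι → V} {y : E}
    (hw : ∀ᶠ z in 𝓝 y, ∀ k, DifferentiableAt ℝ (fun z => w z k) z)
    (hw' : ∀ᶠ z in 𝓝 y, ∀ k, DifferentiableAt ℝ (fun z => w' z k) z)
    (hgram : ∀ᶠ z in 𝓝 y, ∀ k l, inner ℂ (w z k) (w z l) = inner ℂ (w' z k) (w' z l))
    (hspan : Submodule.span ℂ (Set.range (w y)) = ⊤) :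
    ∃ T : E → V →L[ℂ] V, ∀ᶠ z in 𝓝 y, DifferentiableAt ℝ T z ∧
      Submodule.span ℂ (Set.range (w z)) = ⊤ ∧
      ∃ U : V →ₗᵢ[ℂ] V, (∀ k, U (w z k) = w' z k) ∧ ∀ x, T z x = U x := by
  obtain ⟨R, hR⟩ := (Finsupp.linearCombination ℂ (w y)).exists_rightInverse_of_surjective
    ((Finsupp.range_linearCombination ℂ).trans hspan)
  let S : E → V →L[ℂ] V := fun z =>
    LinearMap.toContinuousLinearMap (Finsupp.linearCombination ℂ (w z) ∘ₗ R)
  let S' : E → V →L[ℂ] V := fun z =>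
    LinearMap.toContinuousLinearMap (Finsupp.linearCombination ℂ (w' z) ∘ₗ R)
  have hSy : S y = 1 := by ext1 x; exact DFunLike.congr_fun hR x
  have hunit : ∀ᶠ z in 𝓝 y, IsUnit (S z) :=
    (differentiableAt_linearCombination_comp hw.self_of_nhds R).continuousAt.eventually
      (Units.isOpen.mem_nhds (show IsUnit (S y) from hSy ▸ isUnit_one))
  refine ⟨fun z => S' z * Ring.inverse (S z), ?_⟩
  filter_upwards [hunit, hw, hw', hgram] with z hz hwz hw'z hgramz
  have hinv : ∀ x, S z (Ring.inverse (S z) x) = x :=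
    DFunLike.congr_fun (Ring.mul_inverse_cancel (S z) hz)
  have hspanz : Submodule.span ℂ (Set.range (w z)) = ⊤ := by
    rw [← Finsupp.range_linearCombination, LinearMap.range_eq_top]
    exact fun x => ⟨_, hinv x⟩
  obtain ⟨U, hU⟩ := exists_linearIsometry_of_gram_eq hspanz hgramz
  have hUS : ∀ x, U (S z x) = S' z x := fun x => by
    simp [S, S', Finsupp.linearCombination_apply, Finsupp.sum, hU]
  refine ⟨(differentiableAt_linearCombination_comp hw'z R).mul
    ((differentiableAt_inverse hz).comp z (differentiableAt_linearCombination_comp hwz R)),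
    hspanz, U, hU, fun x => ?_⟩
  rw [mul_apply_eq_comp, ← hUS, hinv]

/-- Differentiate `⟨T x, w'_k⟩ = ⟨x, w_k⟩`: since `T` maps `dw_k` to `dw'_k`, nothing is left but
`⟨(dT) x, w'_k⟩ = 0`. -/
theorem hasFDerivAt_zero_of_transition [FiniteDimensional ℂ V] {w w' : E → ι → V}
    {dw dw' : ι → E →L[ℝ] V} {T : E → V →L[ℂ] V} {z : E} (hT : DifferentiableAt ℝ T z)
    (hTz : ∀ᶠ z' in 𝓝 z, ∃ U : V →ₗᵢ[ℂ] V, (∀ k, U (w z' k) = w' z' k) ∧ ∀ x, T z' x = U x)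
    (hw : ∀ k, HasFDerivAt (fun z => w z k) (dw k) z)
    (hw' : ∀ k, HasFDerivAt (fun z => w' z k) (dw' k) z)
    (hconn : ∀ k l r, inner ℂ (dw k r) (w z l) = inner ℂ (dw' k r) (w' z l))
    (hspan : Submodule.span ℂ (Set.range (w z)) = ⊤) :
    HasFDerivAt T (0 : E →L[ℝ] V →L[ℂ] V) z := by
  obtain ⟨U, hU, hTU⟩ := hTz.self_of_nhds
  have hspan' := span_range_eq_top_of_linearIsometry hspan hU
  have hUdw : ∀ k r, U (dw k r) = dw' k r := fun k r => eq_of_forall_inner_eq hspan' fun l => by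
    rw [← hU l, U.inner_map_map, hconn, hU]
  refine hT.hasFDerivAt.congr_fderiv ?_
  ext r x
  refine eq_of_forall_inner_eq hspan' fun k => ?_
  have hTx : HasFDerivAt (fun z => T z x)
      (((ContinuousLinearMap.apply ℂ V x).restrictScalars ℝ).comp (𝐃 T z)) z :=
    ((ContinuousLinearMap.apply ℂ V x).restrictScalars ℝ).hasFDerivAt.comp z hT.hasFDerivAt
  have hinner : ∀ᶠ z' in 𝓝 z, inner ℂ (T z' x) (w' z' k) = inner ℂ x (w z' k) := by
    filter_upwards [hTz] with z' ⟨U', hU', hTU'⟩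
    rw [hTU', ← hU', U'.inner_map_map]
  have hderiv := inner_add_inner_of_eventuallyEq hinner hTx (hw' k) (hasFDerivAt_const x z) (hw k) r
  rw [hTU, ← hUdw, U.inner_map_map] at hderiv
  simpa using hderiv

theorem exists_linearIsometry_of_eventually_gram_eq [FiniteDimensional ℂ V] {w w' : E → ι → V}
    {dw dw' : E → ι → E →L[ℝ] V} {y : E}
    (hw : ∀ᶠ z in 𝓝 y, ∀ k, HasFDerivAt (fun z => w z k) (dw z k) z)
    (hw' : ∀ᶠ z in 𝓝 y, ∀ k, HasFDerivAt (fun z => w' z k) (dw' z k) z)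
    (hgram : ∀ᶠ z in 𝓝 y, ∀ k l, inner ℂ (w z k) (w z l) = inner ℂ (w' z k) (w' z l))
    (hconn : ∀ᶠ z in 𝓝 y, ∀ k l r, inner ℂ (dw z k r) (w z l) = inner ℂ (dw' z k r) (w' z l))
    (hspan : Submodule.span ℂ (Set.range (w y)) = ⊤) :
    ∃ U : V →ₗᵢ[ℂ] V, ∀ᶠ z in 𝓝 y, ∀ k, U (w z k) = w' z k := by
  obtain ⟨T, hT⟩ := exists_differentiable_transition
    (hw.mono fun z hz k => (hz k).differentiableAt)
    (hw'.mono fun z hz k => (hz k).differentiableAt) hgram hspan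
  have hconst : ∀ᶠ z in 𝓝 y, T z = T y := by
    apply eventually_eq_of_eventually_hasFDerivAt_zero
    filter_upwards [hw, hw', hconn, hT.eventually_nhds] with z hwz hw'z hconnz hTz
    exact hasFDerivAt_zero_of_transition hTz.self_of_nhds.1 (hTz.mono fun z' hz' => hz'.2.2) hwz
      hw'z hconnz hTz.self_of_nhds.2.1
  obtain ⟨-, -, U, -, hU⟩ := hT.self_of_nhds
  refine ⟨U, ?_⟩
  filter_upwards [hconst, hT] with z hz ⟨_, _, U', hU', hTU'⟩ k
  rw [← hU, ← hz, hTU', hU']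

end MovingFrame

section Jets

variable {E : Type*} [NormedAddCommGroup E] [NormedSpace ℝ E]
  {V : Type*} [NormedAddCommGroup V] [InnerProductSpace ℂ V]
  {V' : Type*} [NormedAddCommGroup V'] [InnerProductSpace ℂ V']
  {Ω : Set E} {J : E → E →L[ℝ] E} {y : E}

/-- The first and second derivatives of `f` at `y`, as one family of vectors: when they span the
target they serve as a moving frame along `f`. -/
def jetFamily (f : E → V) (y : E) : E ⊕ E × E → V :=
  Sum.elim (fun v => 𝐃 f y v) (fun p => 𝐃 (𝐃 f) y p.1 p.2)

/-- The derivative of `jetFamily f` in the base point. -/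
def jetFamilyDeriv (f : E → V) (y : E) : E ⊕ E × E → E →L[ℝ] V :=
  Sum.elim (fun v => (𝐃 (𝐃 f) y).flip v) (fun p => ((𝐃 (𝐃 (𝐃 f)) y).flip p.1).flip p.2)

theorem hasFDerivAt_jetFamily {f : E → V} (hf : ContDiffAt ℝ ∞ f y) :
    ∀ k, HasFDerivAt (fun z => jetFamily f z k) (jetFamilyDeriv f y k) y
  | Sum.inl v => hasFDerivAt_fderiv_apply hf v
  | Sum.inr (u, v) => hasFDerivAt_fderiv_fderiv_apply hf u v

theorem eq_of_eventually_apply_fderiv_eq {f : E → V} {U U' : V →L[ℂ] V'}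
    (hf : ContDiffAt ℝ ∞ f y) (hspan : Submodule.span ℂ (Set.range (jetFamily f y)) = ⊤)
    (h : ∀ᶠ z in 𝓝 y, ∀ v, U (𝐃 f z v) = U' (𝐃 f z v)) : U = U' := by
  refine ContinuousLinearMap.coe_injective (LinearMap.ext_on_range hspan ?_)
  rintro (v | ⟨u, v⟩)
  · exact h.self_of_nhds v
  · have hderiv (L : V →L[ℂ] V') : HasFDerivAt (fun z => L (𝐃 f z v))
        ((L.restrictScalars ℝ).comp ((𝐃 (𝐃 f) y).flip v)) y :=
      (L.restrictScalars ℝ).hasFDerivAt.comp y (hasFDerivAt_fderiv_apply hf v)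
    exact DFunLike.congr_fun ((hderiv U).unique
      ((hderiv U').congr_of_eventuallyEq (h.mono fun z hz => hz v))) u

namespace IsIsometricPairOn

theorem inner_jetFamily {f : E → V} {g : E → V'} (h : IsIsometricPairOn Ω J f g) (hy : y ∈ Ω) :
    ∀ k l, inner ℂ (jetFamily f y k) (jetFamily f y l) =
      inner ℂ (jetFamily g y k) (jetFamily g y l)
  | Sum.inl v, Sum.inl s => h.inner_fderiv y hy v s
  | Sum.inl v, Sum.inr (s, w) => h.inner_fderiv_fderiv2 hy s w v
  | Sum.inr (u, v), Sum.inl s => h.inner_fderiv2_fderiv hy u v s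
  | Sum.inr (u, v), Sum.inr (s, w) => h.inner_fderiv2_fderiv2 hy u v s w

theorem inner_jetFamilyDeriv {f : E → V} {g : E → V'} (h : IsIsometricPairOn Ω J f g)
    (hy : y ∈ Ω) : ∀ k l r, inner ℂ (jetFamilyDeriv f y k r) (jetFamily f y l) =
      inner ℂ (jetFamilyDeriv g y k r) (jetFamily g y l)
  | Sum.inl v, Sum.inl s, r => h.inner_fderiv2_fderiv hy r v s
  | Sum.inl v, Sum.inr (s, w), r => h.inner_fderiv2_fderiv2 hy r v s w
  | Sum.inr (u, v), Sum.inl s, r => h.inner_fderiv3_fderiv hy r u v s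
  | Sum.inr (u, v), Sum.inr (s, w), r => h.inner_fderiv3_fderiv2 hy r u v s w

theorem exists_linearIsometry_fderiv [FiniteDimensional ℂ V] {f g : E → V}
    (h : IsIsometricPairOn Ω J f g) (hy : y ∈ Ω)
    (hspan : Submodule.span ℂ (Set.range (jetFamily f y)) = ⊤) :
    ∃ U : V →ₗᵢ[ℂ] V, ∀ᶠ z in 𝓝 y, ∀ v, 𝐃 g z v = U (𝐃 f z v) := by
  have hΩ : ∀ᶠ z in 𝓝 y, z ∈ Ω := h.left.isOpen.mem_nhds hy
  obtain ⟨U, hU⟩ := exists_linearIsometry_of_eventually_gram_eq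
    (hΩ.mono fun z hz => hasFDerivAt_jetFamily (h.left.contDiffAt hz))
    (hΩ.mono fun z hz => hasFDerivAt_jetFamily (h.right.contDiffAt hz))
    (hΩ.mono fun z hz => h.inner_jetFamily hz) (hΩ.mono fun z hz => h.inner_jetFamilyDeriv hz)
    hspan
  exact ⟨U, hU.mono fun z hz v => (hz (Sum.inl v)).symm⟩

end IsIsometricPairOn

end Jets

/-! ### Vertical submanifolds of the Heisenberg group -/

section HeisenbergForm

variable {n : ℕ}

/-- The Hermitian product of `ℂⁿ`, as a real bilinear map. -/
def innerR (n : ℕ) : EuclideanSpace ℂ (Fin n) →L[ℝ] EuclideanSpace ℂ (Fin n) →L[ℝ] ℂ :=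
  (isBoundedBilinearMap_inner (𝕜 := ℂ) (E := EuclideanSpace ℂ (Fin n))).toContinuousLinearMap

theorem heisΘ_apply (p w : Heis n) : heisΘ p w = w.2 + (inner ℂ p.1 w.1).im := rfl

theorem heisJ_fst (p w : Heis n) : (heisJ p w).1 = Complex.I • w.1 := rfl

theorem heisJ_snd (p w : Heis n) : (heisJ p w).2 = -(inner ℂ p.1 (Complex.I • w.1)).im := rfl

/-- The real bilinear form `v, w ↦ Im ⟨v.z, w.z⟩` on `ℂⁿ × ℝ`, which is the derivative of the
contact form `heisΘ` with respect to the base point. -/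
def heisΘDeriv (n : ℕ) : Heis n →L[ℝ] Heis n →L[ℝ] ℝ :=
  let z := ContinuousLinearMap.fst ℝ (EuclideanSpace ℂ (Fin n)) ℝ
  (ContinuousLinearMap.compL ℝ (Heis n) ℂ ℝ Complex.imCLM).comp ((innerR n).bilinearComp z z)

theorem hasFDerivAt_heisΘ (p : Heis n) :
    HasFDerivAt (heisΘ : Heis n → Heis n →L[ℝ] ℝ) (heisΘDeriv n) p :=
  (heisΘDeriv n).hasFDerivAt.const_add (ContinuousLinearMap.snd ℝ (EuclideanSpace ℂ (Fin n)) ℝ)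

end HeisenbergForm

section

variable {V : Type*} [NormedAddCommGroup V] [InnerProductSpace ℂ V]

theorem mem_orthogonal_span_range {ι : Type*} {w : ι → V} {a : V}
    (h : ∀ i, inner ℂ a (w i) = 0) :
    a ∈ (Submodule.span ℂ (Set.range w))ᗮ := by
  have hle : Submodule.span ℂ (Set.range w) ≤ (ℂ ∙ a)ᗮ := by
    rw [Submodule.span_le, Set.range_subset_iff]
    exact fun i => Submodule.mem_orthogonal_singleton_iff_inner_right.2 (h i)
  exact (Submodule.mem_orthogonal' _ _).2 fun u hu =>
    Submodule.mem_orthogonal_singleton_iff_inner_right.1 (hle hu)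

theorem exists_smul_eq_of_mem_orthogonal [FiniteDimensional ℂ V] {K : Submodule ℂ V}
    (hK : Module.finrank ℂ V ≤ Module.finrank ℂ K + 1) {a b : V} (ha : a ∈ Kᗮ) (hb : b ∈ Kᗮ)
    (ha0 : a ≠ 0) : ∃ c : ℂ, c • a = b := by
  have ha0' : (⟨a, ha⟩ : Kᗮ) ≠ 0 := by simpa using ha0
  have hpos : 0 < Module.finrank ℂ Kᗮ := Module.finrank_pos_iff_exists_ne_zero.2 ⟨_, ha0'⟩
  have hdim : Module.finrank ℂ Kᗮ = 1 := by
    have := K.finrank_add_finrank_orthogonal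
    omega
  obtain ⟨c, hc⟩ := (finrank_eq_one_iff_of_nonzero' _ ha0').1 hdim ⟨b, hb⟩
  exact ⟨c, congrArg Subtype.val hc⟩

end

section ChartExpression

variable {m n : ℕ} {M : Type*} [TopologicalSpace M] [ChartedSpace (Model m) M]

/-- The `ℂⁿ`-component of a map `ι : M → H_n`, in the chart at `x`. -/
def zInChart (ι : M → Heis n) (x : M) : Model m → EuclideanSpace ℂ (Fin n) :=
  (fun y => (ι y).1) ∘ (extChartAt 𝓘(ℝ, Model m) x).symm

theorem contMDiffAt_fst {ι : M → Heis n} {k : WithTop ℕ∞} {x : M}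
    (h : ContMDiffAt 𝓘(ℝ, Model m) 𝓘(ℝ, Heis n) k ι x) :
    ContMDiffAt 𝓘(ℝ, Model m) 𝓘(ℝ, EuclideanSpace ℂ (Fin n)) k (fun y => (ι y).1) x :=
  ((ContinuousLinearMap.fst ℝ (EuclideanSpace ℂ (Fin n)) ℝ).contMDiff.contMDiffAt).comp x h

theorem dvec_fst {ι : M → Heis n} {x : M}
    (h : MDifferentiableAt 𝓘(ℝ, Model m) 𝓘(ℝ, Heis n) ι x) :
    dvec (m := m) (fun y => (ι y).1) x = dz ι x :=
  (((ContinuousLinearMap.fst ℝ (EuclideanSpace ℂ (Fin n)) ℝ).hasMFDerivAt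
    (x := ι x)).comp x h.hasMFDerivAt).mfderiv

end ChartExpression

namespace IsPHSubmanifold

variable {m n : ℕ} {M : Type*} [TopologicalSpace M] [ChartedSpace (Model m) M]
  [IsManifold 𝓘(ℝ, Model m) ∞ M] {S : PHData (Model m) M} {ι : M → Heis n}

theorem contMDiffAt_fst (h : IsPHSubmanifold S ι) (x : M) :
    ContMDiffAt 𝓘(ℝ, Model m) 𝓘(ℝ, EuclideanSpace ℂ (Fin n)) ∞ (fun y => (ι y).1) x :=
  Pseudohermitian.contMDiffAt_fst (h.smooth x)

theorem mdifferentiableAt (h : IsPHSubmanifold S ι) (x : M) :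
    MDifferentiableAt 𝓘(ℝ, Model m) 𝓘(ℝ, Heis n) ι x :=
  (h.smooth x).mdifferentiableAt (by simp)

theorem mdifferentiableAt_fst (h : IsPHSubmanifold S ι) (x : M) :
    MDifferentiableAt 𝓘(ℝ, Model m) 𝓘(ℝ, EuclideanSpace ℂ (Fin n)) (fun y => (ι y).1) x :=
  (h.contMDiffAt_fst x).mdifferentiableAt (by simp)

theorem fderiv_zInChart (h : IsPHSubmanifold S ι) {x : M} {y : Model m}
    (hy : y ∈ (extChartAt 𝓘(ℝ, Model m) x).target) :
    𝐃 (zInChart ι x) y = (dz ι ((extChartAt 𝓘(ℝ, Model m) x).symm y)).comp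
      (mfderiv 𝓘(ℝ, Model m) 𝓘(ℝ, Model m) (extChartAt 𝓘(ℝ, Model m) x).symm y) := by
  rw [← dvec_fst (h.mdifferentiableAt _)]
  exact fderiv_comp_extChartAt_symm hy (h.mdifferentiableAt_fst _)

theorem fderiv_zInChart_self (h : IsPHSubmanifold S ι) (x : M) :
    𝐃 (zInChart ι x) (extChartAt 𝓘(ℝ, Model m) x x) = dz ι x := by
  rw [← dvec_fst (h.mdifferentiableAt _)]
  exact fderiv_comp_extChartAt_symm_self (h.mdifferentiableAt_fst x)

theorem extD_θ (h : IsPHSubmanifold S ι) (x : M) (v w : TangentSpace 𝓘(ℝ, Model m) x) :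
    extD S.θ x v w = 2 * (inner ℂ (dz ι x v) (dz ι x w)).im := by
  have hθ : S.θ = fun x => (heisΘ (ι x)).comp (mfderiv 𝓘(ℝ, Model m) 𝓘(ℝ, Heis n) ι x) :=
    funext fun x => ContinuousLinearMap.ext fun v => h.θ_eq x v
  have hd : HasMFDerivAt 𝓘(ℝ, Model m) 𝓘(ℝ, Heis n →L[ℝ] ℝ) (fun x => heisΘ (ι x)) x
      ((heisΘDeriv n).comp (mfderiv 𝓘(ℝ, Model m) 𝓘(ℝ, Heis n) ι x)) :=
    (hasFDerivAt_heisΘ (ι x)).hasMFDerivAt.comp x (h.mdifferentiableAt x).hasMFDerivAt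
  rw [hθ, extD_comp_mfderiv hd.mdifferentiableAt ((h.smooth x).of_le ENat.LEInfty.out), hd.mfderiv]
  change (inner ℂ (dz ι x v) (dz ι x w)).im - (inner ℂ (dz ι x w) (dz ι x v)).im = _
  rw [← inner_conj_symm (dz ι x w), Complex.conj_im]
  ring

theorem dz_J_of_horizontal (h : IsPHSubmanifold S ι) {x : M} {v : TangentSpace 𝓘(ℝ, Model m) x}
    (hv : S.θ x v = 0) : dz ι x (S.J x v) = Complex.I • dz ι x v :=
  congrArg Prod.fst (h.J_eq x v hv)

theorem eq_zero_of_dz_eq_zero (h : IsPHSubmanifold S ι) {x : M}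
    {v : TangentSpace 𝓘(ℝ, Model m) x} (hz : dz ι x v = 0) (hθ : S.θ x v = 0) : v = 0 := by
  have hz' : (push ι x v).1 = 0 := hz
  rw [h.θ_eq, heisΘ_apply, hz', inner_zero_right, Complex.zero_im, add_zero] at hθ
  exact h.immersion x ((Prod.ext hz' hθ).trans (map_zero _).symm)

theorem le_finrank_span_dz (h : IsPHSubmanifold S ι) (x : M) :
    m ≤ Module.finrank ℂ (Submodule.span ℂ (Set.range (dz (m := m) ι x))) := by
  set K := Submodule.span ℂ (Set.range (dz (m := m) ι x))
  let θ : Model m →ₗ[ℝ] ℝ := (S.θ x).toLinearMap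
  let A : Model m →ₗ[ℝ] EuclideanSpace ℂ (Fin n) := (dz (m := m) ι x).toLinearMap
  have hker : 2 * m ≤ Module.finrank ℝ θ.ker := by
    have hsum := θ.finrank_range_add_finrank_ker
    have hrange := θ.range.finrank_le
    rw [finrank_euclideanSpace, Fintype.card_fin] at hsum
    rw [Module.finrank_self] at hrange
    omega
  let B : θ.ker →ₗ[ℝ] K.restrictScalars ℝ :=
    (A.comp θ.ker.subtype).codRestrict _ fun v => Submodule.subset_span ⟨(v : Model m), rfl⟩
  have hB : Function.Injective B := (injective_iff_map_eq_zero B).2 fun v hBv =>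
    Subtype.ext (h.eq_zero_of_dz_eq_zero (congrArg Subtype.val hBv) v.2)
  have hle := LinearMap.finrank_le_finrank_of_injective hB
  have hK : Module.finrank ℝ (K.restrictScalars ℝ) = 2 * Module.finrank ℂ K :=
    finrank_real_of_complex K
  omega

theorem exists_reeb (h : IsPHSubmanifold S ι) (hv : IsVertical S ι) (x : M) :
    ∃ T : TangentSpace 𝓘(ℝ, Model m) x, dz ι x T = 0 ∧ S.θ x T = 1 ∧ S.J x T = 0 := by
  obtain ⟨-, -, T, hT⟩ := hv x
  rw [add_zero] at hT
  have hz : dz ι x T = 0 := congrArg Prod.fst hT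
  refine ⟨T, hz, ?_, h.pseudohermitian.J_reeb x T fun w => ?_⟩
  · simp [h.θ_eq, hT, heisΘ_apply]
  · simp [h.extD_θ, hz]

theorem exists_horizontal_dz_eq (h : IsPHSubmanifold S ι) (hv : IsVertical S ι) {x : M}
    (v : TangentSpace 𝓘(ℝ, Model m) x) :
    ∃ u : TangentSpace 𝓘(ℝ, Model m) x,
      S.θ x u = 0 ∧ S.J x u = S.J x v ∧ dz ι x u = dz ι x v := by
  obtain ⟨T, hz, hθ, hJ⟩ := h.exists_reeb hv x
  refine ⟨v - S.θ x v • T, ?_, ?_, ?_⟩ <;> simp only [map_sub, map_smul, hz, hθ, hJ] <;> simp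

theorem dz_J (h : IsPHSubmanifold S ι) (hv : IsVertical S ι) (x : M)
    (v : TangentSpace 𝓘(ℝ, Model m) x) : dz ι x (S.J x v) = Complex.I • dz ι x v := by
  obtain ⟨u, hu, hJ, hz⟩ := h.exists_horizontal_dz_eq hv v
  rw [← hJ, h.dz_J_of_horizontal hu, hz]

theorem inner_dz (h : IsPHSubmanifold S ι) (hv : IsVertical S ι) (x : M)
    (v w : TangentSpace 𝓘(ℝ, Model m) x) :
    inner ℂ (dz ι x v) (dz ι x w) =
      ((extD S.θ x v (S.J x w) / 2 : ℝ) : ℂ) + ((extD S.θ x v w / 2 : ℝ) : ℂ) * Complex.I := by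
  rw [h.extD_θ, h.extD_θ, h.dz_J hv, inner_smul_right]
  apply Complex.ext <;> simp

theorem isJHolomorphicOn (h : IsPHSubmanifold S ι) (hv : IsVertical S ι) (x : M) :
    IsJHolomorphicOn (extChartAt 𝓘(ℝ, Model m) x).target (endoInChart S.J x) (zInChart ι x) where
  isOpen := isOpen_extChartAt_target x
  smooth y hy := (contDiffAt_comp_extChartAt_symm le_rfl hy (h.contMDiffAt_fst _)).contDiffWithinAt
  smooth_J := h.pseudohermitian.smooth_J x
  fderiv_J y hy v := by
    rw [h.fderiv_zInChart hy]
    exact (congrArg (dz ι _) (mfderiv_extChartAt_symm_mfderiv_extChartAt hy _)).trans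
      (h.dz_J hv _ _)

theorem isIsometricPairOn {ι' : M → Heis n} (h : IsPHSubmanifold S ι)
    (hv : IsVertical S ι) (h' : IsPHSubmanifold S ι') (hv' : IsVertical S ι') (x : M) :
    IsIsometricPairOn (extChartAt 𝓘(ℝ, Model m) x).target (endoInChart S.J x)
      (zInChart ι x) (zInChart ι' x) where
  left := h.isJHolomorphicOn hv x
  right := h'.isJHolomorphicOn hv' x
  inner_fderiv y hy v w := by
    rw [h.fderiv_zInChart hy, h'.fderiv_zInChart hy]
    exact (h.inner_dz hv _ _ _).trans (h'.inner_dz hv' _ _ _).symm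

section NormalSections

variable {U : Set M} {ζ : M → EuclideanSpace ℂ (Fin n)} {x : M}

theorem inner_normal_dz (h : IsPHSubmanifold S ι) (hv : IsVertical S ι) (hζ : IsNormalOn S ι U ζ)
    (hx : x ∈ U) (v : TangentSpace 𝓘(ℝ, Model m) x) : inner ℂ (ζ x) (dz ι x v) = 0 := by
  obtain ⟨u, hu, -, hz⟩ := h.exists_horizontal_dz_eq hv v
  rw [← hz]
  exact inner_eq_zero_symm.1 (hζ.2 x hx u hu)

theorem inner_normal_fderiv_fderiv (h : IsPHSubmanifold S ι) (hv : IsVertical S ι) (hU : IsOpen U)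
    (hζ : IsNormalOn S ι U ζ) (hx : x ∈ U) (v w : TangentSpace 𝓘(ℝ, Model m) x) :
    inner ℂ (ζ x) (𝐃 (𝐃 (zInChart ι x)) (extChartAt 𝓘(ℝ, Model m) x x) v w) =
      -inner ℂ (dvec ζ x v) (dz ι x w) := by
  set c := extChartAt 𝓘(ℝ, Model m) x with hc
  have hct : c x ∈ c.target := mem_extChartAt_target x
  have hsx : c.symm (c x) = x := extChartAt_to_inv x
  have hζx : ContMDiffAt 𝓘(ℝ, Model m) 𝓘(ℝ, EuclideanSpace ℂ (Fin n)) ∞ ζ x :=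
    hζ.1.contMDiffAt (hU.mem_nhds hx)
  have hζc : HasFDerivAt (ζ ∘ c.symm) (𝐃 (ζ ∘ c.symm) (c x)) (c x) :=
    hasFDerivAt_of_contDiffAt (contDiffAt_comp_extChartAt_symm le_rfl hct (by rwa [← hc, hsx]))
  have hzero : ∀ᶠ y in 𝓝 (c x), inner ℂ ((ζ ∘ c.symm) y) (𝐃 (zInChart ι x) y w) =
      inner ℂ (0 : EuclideanSpace ℂ (Fin n)) (0 : EuclideanSpace ℂ (Fin n)) := by
    filter_upwards [(tendsto_extChartAt_symm x).eventually (hU.mem_nhds hx),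
      extChartAt_target_mem_nhds x] with y hyU hy
    rw [h.fderiv_zInChart hy, inner_zero_left]
    exact h.inner_normal_dz hv hζ hyU _
  have hsum := inner_add_inner_of_eventuallyEq hzero hζc
    (hasFDerivAt_fderiv_apply ((h.isJHolomorphicOn hv x).contDiffAt hct) w)
    (hasFDerivAt_const _ _) (hasFDerivAt_const _ _) v
  rw [fderiv_comp_extChartAt_symm_self (hζx.mdifferentiableAt (by simp)),
    h.fderiv_zInChart_self] at hsum
  simp only [Function.comp_apply, hsx, inner_zero_left, inner_zero_right, add_zero] at hsum
  exact eq_neg_of_add_eq_zero_left hsum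

theorem inner_dvec_dz_comm (h : IsPHSubmanifold S ι) (hv : IsVertical S ι) (hU : IsOpen U)
    (hζ : IsNormalOn S ι U ζ) (hx : x ∈ U) (v w : TangentSpace 𝓘(ℝ, Model m) x) :
    inner ℂ (dvec ζ x v) (dz ι x w) = inner ℂ (dvec ζ x w) (dz ι x v) := by
  have hsymm := fderiv_fderiv_comm ((h.isJHolomorphicOn hv x).contDiffAt
    (mem_extChartAt_target x)) v w
  rw [← neg_inj, ← h.inner_normal_fderiv_fderiv hv hU hζ hx,
    ← h.inner_normal_fderiv_fderiv hv hU hζ hx]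
  exact congrArg (inner ℂ (ζ x)) hsymm

theorem inner_dvec_J_dz (h : IsPHSubmanifold S ι) (hv : IsVertical S ι) (hU : IsOpen U)
    (hζ : IsNormalOn S ι U ζ) (hx : x ∈ U) (v w : TangentSpace 𝓘(ℝ, Model m) x) :
    inner ℂ (dvec ζ x (S.J x v)) (dz ι x w) = Complex.I * inner ℂ (dvec ζ x v) (dz ι x w) := by
  rw [h.inner_dvec_dz_comm hv hU hζ hx, h.dz_J hv, inner_smul_right,
    h.inner_dvec_dz_comm hv hU hζ hx]

theorem secondForm_eq (h : IsPHSubmanifold S ι) (hv : IsVertical S ι) (hU : IsOpen U)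
    (hζ : IsNormalOn S ι U ζ) (hx : x ∈ U) (X Y : TangentSpace 𝓘(ℝ, Model m) x) :
    secondForm S ι ζ x X Y = -inner ℂ (dvec ζ x Y) (dz ι x X) := by
  rw [secondForm, inner_smul_left, inner_add_left, inner_smul_left,
    h.inner_dvec_J_dz hv hU hζ hx, Complex.conj_I, ← mul_assoc]
  simp only [map_div₀, map_one, Complex.conj_ofNat, neg_mul, Complex.I_mul_I]
  ring

end NormalSections

theorem span_jetFamily {ι : M → Heis (m + 1)} (h : IsPHSubmanifold S ι) (hv : IsVertical S ι)
    {x : M} (hx : ¬ IsFlatPoint S ι x) : Submodule.span ℂ (Set.range (jetFamily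
      (zInChart ι x) (extChartAt 𝓘(ℝ, Model m) x x))) = ⊤ := by
  by_contra hne
  obtain ⟨a, haK, ha0⟩ := Submodule.exists_mem_ne_zero_of_ne_bot
    (mt Submodule.orthogonal_eq_bot_iff.1 hne)
  have hjet : ∀ i, inner ℂ a (jetFamily (zInChart ι x) (extChartAt 𝓘(ℝ, Model m) x x) i) = 0 :=
    fun i => (Submodule.mem_orthogonal' _ _).1 haK _ (Submodule.subset_span ⟨i, rfl⟩)
  have ha : ∀ v : TangentSpace 𝓘(ℝ, Model m) x, inner ℂ a (dz ι x v) = 0 := fun v => by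
    rw [← h.fderiv_zInChart_self]
    exact hjet (Sum.inl v)
  refine hx fun U hU hxU ζ hζ X Y _ _ => ?_
  have hdim : Module.finrank ℂ (EuclideanSpace ℂ (Fin (m + 1))) ≤
      Module.finrank ℂ (Submodule.span ℂ (Set.range (dz (m := m) ι x))) + 1 := by
    rw [finrank_euclideanSpace, Fintype.card_fin]
    exact Nat.succ_le_succ (h.le_finrank_span_dz x)
  obtain ⟨k, hk⟩ := exists_smul_eq_of_mem_orthogonal hdim (mem_orthogonal_span_range ha)
    (mem_orthogonal_span_range (h.inner_normal_dz hv hζ hxU)) ha0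
  rw [h.secondForm_eq hv hU hζ hxU, ← h.inner_normal_fderiv_fderiv hv hU hζ hxU, ← hk,
    inner_smul_left]
  exact mul_eq_zero_of_right _ (hjet (Sum.inr (Y, X)))

end IsPHSubmanifold

/-! ### Congruence -/

section RigidMotion

variable {n : ℕ}

/-- The unitary maps of `ℂⁿ`. -/
abbrev UnitaryMap (n : ℕ) : Type := EuclideanSpace ℂ (Fin n) ≃ₗᵢ[ℂ] EuclideanSpace ℂ (Fin n)

/-- A unitary map, as a continuous real-linear map. -/
def UnitaryMap.toRealCLM (V : UnitaryMap n) :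
    EuclideanSpace ℂ (Fin n) →L[ℝ] EuclideanSpace ℂ (Fin n) :=
  V.toLinearIsometry.toContinuousLinearMap.restrictScalars ℝ

/-- The linear part of `heisMap`, which is also its differential at every point. -/
def heisLinear (V : UnitaryMap n) (b : EuclideanSpace ℂ (Fin n)) : Heis n →L[ℝ] Heis n :=
  let Vz := V.toRealCLM.comp (ContinuousLinearMap.fst ℝ _ ℝ)
  Vz.prod (ContinuousLinearMap.snd ℝ _ ℝ - (Complex.imCLM.comp (innerR n b)).comp Vz)

theorem heisLinear_apply (V : UnitaryMap n) (b : EuclideanSpace ℂ (Fin n)) (v : Heis n) :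
    heisLinear V b v = (V v.1, v.2 - (inner ℂ b (V v.1)).im) := rfl

/-- The unitary map `V` of `ℂⁿ`, followed by the left translation by `(b, c)`. -/
def heisMap (V : UnitaryMap n) (b : EuclideanSpace ℂ (Fin n)) (c : ℝ) :
    Heis n ≃ₘ^∞⟮𝓘(ℝ, Heis n), 𝓘(ℝ, Heis n)⟯ Heis n where
  toFun p := heisLinear V b p + (b, c)
  invFun q := heisLinear V.symm 0 q + (-V.symm b, -c + (inner ℂ b (q.1 - b)).im)
  left_inv p := by ext <;> simp [heisLinear_apply]
  right_inv q := by
    refine Prod.ext (by simp [heisLinear_apply]) ?_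
    simp only [heisLinear_apply, Prod.snd_add, map_add, map_neg, inner_zero_left, Complex.zero_im,
      LinearIsometryEquiv.apply_symm_apply, inner_sub_right, inner_neg_right, Complex.sub_im,
      Complex.neg_im]
    ring
  contMDiff_toFun := ((heisLinear V b).contDiff.add contDiff_const).contMDiff
  contMDiff_invFun := by
    refine ContDiff.contMDiff ((heisLinear V.symm 0).contDiff.add
      (contDiff_const.prodMk (contDiff_const.add ?_)))
    exact (Complex.imCLM.comp (innerR n b)).contDiff.comp (contDiff_fst.sub contDiff_const)

theorem heisMap_apply (V : UnitaryMap n) (b : EuclideanSpace ℂ (Fin n)) (c : ℝ) (p : Heis n) :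
    heisMap V b c p = (V p.1 + b, p.2 - (inner ℂ b (V p.1)).im + c) := rfl

theorem mfderiv_heisMap (V : UnitaryMap n) (b : EuclideanSpace ℂ (Fin n)) (c : ℝ) (p : Heis n) :
    mfderiv 𝓘(ℝ, Heis n) 𝓘(ℝ, Heis n) (heisMap V b c) p = heisLinear V b := by
  rw [mfderiv_eq_fderiv]
  exact ((heisLinear V b).hasFDerivAt.add_const (b, c)).fderiv

theorem heisΘ_heisLinear (V : UnitaryMap n) (b : EuclideanSpace ℂ (Fin n)) (c : ℝ)
    (p v : Heis n) : heisΘ (heisMap V b c p) (heisLinear V b v) = heisΘ p v := by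
  rw [heisΘ_apply, heisΘ_apply, heisLinear_apply, heisMap_apply, inner_add_left,
    V.inner_map_map, Complex.add_im]
  ring

theorem heisLinear_heisJ (V : UnitaryMap n) (b : EuclideanSpace ℂ (Fin n)) (c : ℝ)
    (p v : Heis n) :
    heisLinear V b (heisJ p v) = heisJ (heisMap V b c p) (heisLinear V b v) := by
  refine Prod.ext (map_smul V Complex.I v.1) ?_
  simp only [heisLinear_apply, heisJ_fst, heisJ_snd, heisMap_apply]
  rw [← map_smul, inner_add_left, V.inner_map_map, Complex.add_im]
  ring

theorem isRigidMotion_heisMap (V : UnitaryMap n) (b : EuclideanSpace ℂ (Fin n)) (c : ℝ) :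
    IsRigidMotion (heisMap V b c) := by
  refine ⟨fun p v => ?_, fun p v _ => ?_⟩ <;> rw [mfderiv_heisMap]
  · exact heisΘ_heisLinear V b c p v
  · exact heisLinear_heisJ V b c p v

end RigidMotion

section Congruence

variable {m n : ℕ} {M : Type*} [TopologicalSpace M] [ChartedSpace (Model m) M]
  [IsManifold 𝓘(ℝ, Model m) ∞ M]

theorem sub_eq_sub_of_push_eq [PreconnectedSpace M] {F : Type*} [NormedAddCommGroup F]
    [NormedSpace ℝ F] {ι ι' : M → Heis n} {L L' : Heis n →L[ℝ] F}
    (hι : ∀ x, MDifferentiableAt 𝓘(ℝ, Model m) 𝓘(ℝ, Heis n) ι x)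
    (hι' : ∀ x, MDifferentiableAt 𝓘(ℝ, Model m) 𝓘(ℝ, Heis n) ι' x)
    (h : ∀ x, ∀ v : TangentSpace 𝓘(ℝ, Model m) x, L' (push ι' x v) = L (push ι x v)) (x y : M) :
    L' (ι' x) - L (ι x) = L' (ι' y) - L (ι y) := by
  have hcomp (L : Heis n →L[ℝ] F) {ι : M → Heis n} {x : M}
      (hι : MDifferentiableAt 𝓘(ℝ, Model m) 𝓘(ℝ, Heis n) ι x) :
      HasMFDerivAt 𝓘(ℝ, Model m) 𝓘(ℝ, F) (fun x => L (ι x)) x (L.comp (push ι x)) :=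
    (L.hasMFDerivAt (x := ι x)).comp x hι.hasMFDerivAt
  have hd (x : M) : HasMFDerivAt 𝓘(ℝ, Model m) 𝓘(ℝ, F) (fun x => L' (ι' x) - L (ι x)) x
      (0 : TangentSpace 𝓘(ℝ, Model m) x →L[ℝ] F) :=
    ((hcomp L' (hι' x)).sub (hcomp L (hι x))).congr_mfderiv
      (ContinuousLinearMap.ext fun v => sub_eq_zero.2 (h x v))
  exact eq_of_mfderiv_eq_zero (fun x => (hd x).mdifferentiableAt) (fun x => (hd x).mfderiv) x y

namespace IsPHSubmanifold

variable {S : PHData (Model m) M}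

theorem exists_eq_heisMap_of_dz_eq [ConnectedSpace M] {ι ι' : M → Heis n}
    (h : IsPHSubmanifold S ι) (h' : IsPHSubmanifold S ι') {V : UnitaryMap n}
    (hV : ∀ x, ∀ v : TangentSpace 𝓘(ℝ, Model m) x, dz ι' x v = V (dz ι x v)) :
    ∃ b c, ∀ x, ι' x = heisMap V b c (ι x) := by
  let x₀ : M := Classical.arbitrary M
  set b := (ι' x₀).1 - V (ι x₀).1
  have hz (x : M) : (ι' x).1 = V (ι x).1 + b := eq_add_of_sub_eq' <|
    sub_eq_sub_of_push_eq (L := V.toRealCLM.comp (ContinuousLinearMap.fst ℝ _ ℝ))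
      (L' := ContinuousLinearMap.fst ℝ _ ℝ) h.mdifferentiableAt h'.mdifferentiableAt hV x x₀
  -- Both immersions pull `Θ` back to `S.θ`; this determines `dt` from `dz`.
  have ht (x : M) (v : TangentSpace 𝓘(ℝ, Model m) x) :
      (push ι' x v).2 = (heisLinear V b (push ι x v)).2 := by
    have hθ := (h.θ_eq x v).symm.trans (h'.θ_eq x v)
    rw [heisΘ_apply, heisΘ_apply, hz, show (push ι' x v).1 = V (push ι x v).1 from hV x v,
      inner_add_left, V.inner_map_map, Complex.add_im] at hθ
    rw [heisLinear_apply]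
    linarith
  refine ⟨b, (ι' x₀).2 - (heisLinear V b (ι x₀)).2, fun x => Prod.ext (hz x) ?_⟩
  exact eq_add_of_sub_eq' <| sub_eq_sub_of_push_eq
    (L := (ContinuousLinearMap.snd ℝ _ ℝ).comp (heisLinear V b))
    (L' := ContinuousLinearMap.snd ℝ _ ℝ) h.mdifferentiableAt h'.mdifferentiableAt ht x x₀

variable {ι ι' : M → Heis (m + 1)}

theorem exists_linearIsometry_dz (h : IsPHSubmanifold S ι) (hv : IsVertical S ι)
    (h' : IsPHSubmanifold S ι') (hv' : IsVertical S ι') {x : M} (hx : ¬ IsFlatPoint S ι x) :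
    ∃ U : EuclideanSpace ℂ (Fin (m + 1)) →ₗᵢ[ℂ] EuclideanSpace ℂ (Fin (m + 1)),
      ∀ᶠ x' in 𝓝 x, ∀ v : TangentSpace 𝓘(ℝ, Model m) x', dz ι' x' v = U (dz ι x' v) := by
  obtain ⟨U, hU⟩ := (h.isIsometricPairOn hv h' hv' x).exists_linearIsometry_fderiv
    (mem_extChartAt_target x) (h.span_jetFamily hv hx)
  refine ⟨U, ?_⟩
  filter_upwards [(continuousAt_extChartAt x).eventually hU,
    extChartAt_source_mem_nhds (I := 𝓘(ℝ, Model m)) x] with x' hx' hsource v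
  set c := extChartAt 𝓘(ℝ, Model m) x
  obtain ⟨y, hy, rfl⟩ : ∃ y ∈ c.target, c.symm y = x' :=
    ⟨c x', c.map_source hsource, c.left_inv hsource⟩
  have hchart := hx' (mfderiv 𝓘(ℝ, Model m) 𝓘(ℝ, Model m) c (c.symm y) v)
  rw [c.right_inv hy, h.fderiv_zInChart hy, h'.fderiv_zInChart hy] at hchart
  have hinv := mfderiv_extChartAt_symm_mfderiv_extChartAt hy v
  exact (congrArg (dz ι' _) hinv).symm.trans
    (hchart.trans (congrArg (fun w => U (dz ι _ w)) hinv))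

theorem linearIsometry_dz_unique (h : IsPHSubmanifold S ι) (hv : IsVertical S ι) {x : M}
    (hx : ¬ IsFlatPoint S ι x)
    {U U' : EuclideanSpace ℂ (Fin (m + 1)) →ₗᵢ[ℂ] EuclideanSpace ℂ (Fin (m + 1))}
    (hU : ∀ᶠ x' in 𝓝 x, ∀ v : TangentSpace 𝓘(ℝ, Model m) x', U (dz ι x' v) = U' (dz ι x' v)) :
    U = U' := by
  refine LinearIsometry.toContinuousLinearMap_injective (eq_of_eventually_apply_fderiv_eq
    ((h.isJHolomorphicOn hv x).contDiffAt (mem_extChartAt_target x)) (h.span_jetFamily hv hx) ?_)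
  filter_upwards [(tendsto_extChartAt_symm x).eventually hU, extChartAt_target_mem_nhds x]
    with y hyU hy v
  rw [h.fderiv_zInChart hy]
  exact hyU _

theorem exists_unitaryMap_dz [PreconnectedSpace M] (h : IsPHSubmanifold S ι)
    (hv : IsVertical S ι) (hf : ∀ x, ¬ IsFlatPoint S ι x) (h' : IsPHSubmanifold S ι')
    (hv' : IsVertical S ι') : ∃ V : UnitaryMap (m + 1),
      ∀ x, ∀ v : TangentSpace 𝓘(ℝ, Model m) x, dz ι' x v = V (dz ι x v) := by
  choose U hU using fun x => h.exists_linearIsometry_dz hv h' hv' (hf x)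
  have hconst : IsLocallyConstant U := by
    refine (IsLocallyConstant.iff_eventually_eq U).2 fun x => ?_
    filter_upwards [(hU x).eventually_nhds] with x' hx'
    refine h.linearIsometry_dz_unique hv (hf x') ?_
    filter_upwards [hU x', hx'] with x'' hx'U hxU v
    rw [← hx'U, ← hxU]
  obtain ⟨U₀, hU₀⟩ := hconst.exists_eq_const
  refine ⟨U₀.toLinearIsometryEquiv rfl, fun x v => ?_⟩
  rw [(hU x).self_of_nhds v, hU₀]
  rfl

theorem exists_eq_heisMap [ConnectedSpace M] (h : IsPHSubmanifold S ι)
    (hv : IsVertical S ι) (hf : ∀ x, ¬ IsFlatPoint S ι x) (h' : IsPHSubmanifold S ι')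
    (hv' : IsVertical S ι') : ∃ V b c, ∀ x, ι' x = heisMap V b c (ι x) := by
  obtain ⟨V, hV⟩ := h.exists_unitaryMap_dz hv hf h' hv'
  exact ⟨V, h.exists_eq_heisMap_of_dz_eq h' hV⟩

end IsPHSubmanifold

end Congruence

section Transformation

variable {m n : ℕ} {M : Type*} [TopologicalSpace M] [ChartedSpace (Model m) M]
  {N : Type*} [TopologicalSpace N] [ChartedSpace (Model m) N]
  {SM : PHData (Model m) M} {SN : PHData (Model m) N}
  {φ : M ≃ₘ^∞⟮𝓘(ℝ, Model m), 𝓘(ℝ, Model m)⟯ N} {ιM : M → Heis n} {ιN : N → Heis n}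

theorem mdifferentiableAt_diffeomorph (φ : M ≃ₘ^∞⟮𝓘(ℝ, Model m), 𝓘(ℝ, Model m)⟯ N) (x : M) :
    MDifferentiableAt 𝓘(ℝ, Model m) 𝓘(ℝ, Model m) φ x :=
  φ.contMDiff.contMDiffAt.mdifferentiableAt (by simp)

theorem mfderiv_diffeomorph_bijective (φ : M ≃ₘ^∞⟮𝓘(ℝ, Model m), 𝓘(ℝ, Model m)⟯ N) (x : M) :
    Function.Bijective (mfderiv 𝓘(ℝ, Model m) 𝓘(ℝ, Model m) φ x) :=
  (φ.mfderivToContinuousLinearEquiv (by simp) x).bijective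

theorem push_comp {x : M} (h : MDifferentiableAt 𝓘(ℝ, Model m) 𝓘(ℝ, Heis n) ιN (φ x))
    (v : TangentSpace 𝓘(ℝ, Model m) x) :
    push (fun y => ιN (φ y)) x v =
      push ιN (φ x) (mfderiv 𝓘(ℝ, Model m) 𝓘(ℝ, Model m) φ x v) :=
  DFunLike.congr_fun (mfderiv_comp x h (mdifferentiableAt_diffeomorph φ x)) v

theorem push_mfderiv_of_eq {Φ : Heis n ≃ₘ^∞⟮𝓘(ℝ, Heis n), 𝓘(ℝ, Heis n)⟯ Heis n}
    (h : ∀ x, ιN (φ x) = Φ (ιM x)) {x : M}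
    (hM : MDifferentiableAt 𝓘(ℝ, Model m) 𝓘(ℝ, Heis n) ιM x)
    (hN : MDifferentiableAt 𝓘(ℝ, Model m) 𝓘(ℝ, Heis n) ιN (φ x))
    (v : TangentSpace 𝓘(ℝ, Model m) x) :
    push ιN (φ x) (mfderiv 𝓘(ℝ, Model m) 𝓘(ℝ, Model m) φ x v) =
      mfderiv 𝓘(ℝ, Heis n) 𝓘(ℝ, Heis n) Φ (ιM x) (push ιM x v) := by
  rw [← push_comp hN, show (fun y => ιN (φ y)) = Φ ∘ ιM from funext h]
  exact DFunLike.congr_fun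
    (mfderiv_comp x (Φ.contMDiff.contMDiffAt.mdifferentiableAt (by simp)) hM) v

variable [IsManifold 𝓘(ℝ, Model m) ∞ N]

theorem IsVertical.comp_diffeomorph (hv : IsVertical SN ιN) (hN : IsPHSubmanifold SN ιN) :
    IsVertical SM (fun x => ιN (φ x)) := by
  intro x
  obtain ⟨hθ, -, T, hT⟩ := hv (φ x)
  obtain ⟨T', rfl⟩ := (mfderiv_diffeomorph_bijective φ x).2 T
  exact ⟨hθ, fun v _ => by simp, T', by rw [push_comp (hN.mdifferentiableAt _), hT]⟩

variable [IsManifold 𝓘(ℝ, Model m) ∞ M]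

theorem IsPHSubmanifold.comp_diffeomorph (hN : IsPHSubmanifold SN ιN)
    (hM : SM.IsPseudohermitian m) (hφ : IsPHTransformation SM SN φ) :
    IsPHSubmanifold SM (fun x => ιN (φ x)) where
  pseudohermitian := hM
  smooth := hN.smooth.comp φ.contMDiff
  immersion x v w hvw := by
    rw [push_comp (hN.mdifferentiableAt _), push_comp (hN.mdifferentiableAt _)] at hvw
    exact (mfderiv_diffeomorph_bijective φ x).1 (hN.immersion _ hvw)
  θ_eq x v := by
    rw [push_comp (hN.mdifferentiableAt _), ← hN.θ_eq, hφ.1]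
  J_eq x v hv := by
    rw [push_comp (hN.mdifferentiableAt _), push_comp (hN.mdifferentiableAt _), hφ.2 x v hv,
      hN.J_eq _ _ (by rw [hφ.1, hv])]

theorem isPHTransformation_of_isRigidMotion (hM : IsPHSubmanifold SM ιM)
    (hN : IsPHSubmanifold SN ιN) {Φ : Heis n ≃ₘ^∞⟮𝓘(ℝ, Heis n), 𝓘(ℝ, Heis n)⟯ Heis n}
    (hΦ : IsRigidMotion Φ) (h : ∀ x, ιN (φ x) = Φ (ιM x)) : IsPHTransformation SM SN φ := by
  have hpush (x : M) := push_mfderiv_of_eq h (hM.mdifferentiableAt x) (hN.mdifferentiableAt (φ x))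
  have hθ : ∀ x v, SN.θ (φ x) (mfderiv 𝓘(ℝ, Model m) 𝓘(ℝ, Model m) φ x v) = SM.θ x v := by
    intro x v
    rw [hN.θ_eq, hpush, h, hM.θ_eq]
    exact hΦ.1 (ιM x) (push ιM x v)
  refine ⟨hθ, fun x v hv => hN.immersion (φ x) ?_⟩
  rw [hpush, hM.J_eq x v hv, hN.J_eq _ _ (by rw [hθ, hv]), hpush, h]
  exact hΦ.2 (ιM x) (push ιM x v) ((hM.θ_eq x v).symm.trans hv)

theorem IsPHTransformation.exists_eq_heisMap [ConnectedSpace M] {ιM : M → Heis (m + 1)}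
    {ιN : N → Heis (m + 1)} (hφ : IsPHTransformation SM SN φ) (hM : IsPHSubmanifold SM ιM)
    (hMv : IsVertical SM ιM) (hMf : ∀ x, ¬ IsFlatPoint SM ιM x) (hN : IsPHSubmanifold SN ιN)
    (hNv : IsVertical SN ιN) : ∃ V b c, ∀ x, ιN (φ x) = heisMap V b c (ιM x) :=
  hM.exists_eq_heisMap hMv hMf (hN.comp_diffeomorph hM.pseudohermitian hφ) (hNv.comp_diffeomorph hN)

theorem isPHTransformation_iff_exists_isRigidMotion [ConnectedSpace M] {ιM : M → Heis (m + 1)}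
    {ιN : N → Heis (m + 1)} (hM : IsPHSubmanifold SM ιM) (hMv : IsVertical SM ιM)
    (hMf : ∀ x, ¬ IsFlatPoint SM ιM x) (hN : IsPHSubmanifold SN ιN) (hNv : IsVertical SN ιN) :
    IsPHTransformation SM SN φ ↔
      ∃ Φ : Heis (m + 1) ≃ₘ^∞⟮𝓘(ℝ, Heis (m + 1)), 𝓘(ℝ, Heis (m + 1))⟯ Heis (m + 1),
        IsRigidMotion Φ ∧ ∀ x, ιN (φ x) = Φ (ιM x) := by
  refine ⟨fun hφ => ?_, fun ⟨_, hΦ, h⟩ => isPHTransformation_of_isRigidMotion hM hN hΦ h⟩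
  obtain ⟨V, b, c, h⟩ := hφ.exists_eq_heisMap hM hMv hMf hN hNv
  exact ⟨heisMap V b c, isRigidMotion_heisMap V b c, h⟩

end Transformation

/-! ### Transport of Darboux frames -/

section Transport

variable {m n : ℕ} {M : Type*} [TopologicalSpace M] [ChartedSpace (Model m) M]
  {N : Type*} [TopologicalSpace N] [ChartedSpace (Model m) N]
  {SM : PHData (Model m) M} {SN : PHData (Model m) N}
  {φ : M ≃ₘ^∞⟮𝓘(ℝ, Model m), 𝓘(ℝ, Model m)⟯ N} {V : UnitaryMap n} {U : Set M}
  {ζ : M → EuclideanSpace ℂ (Fin n)}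

/-- The section over `N` which corresponds to the section `ζ` over `M` under `φ : M → N`, if the
left invariant frame of `H_n` is rotated by `V`. -/
def pushSection (φ : M ≃ₘ^∞⟮𝓘(ℝ, Model m), 𝓘(ℝ, Model m)⟯ N) (V : UnitaryMap n)
    (ζ : M → EuclideanSpace ℂ (Fin n)) (y : N) : EuclideanSpace ℂ (Fin n) :=
  V (ζ (φ.symm y))

theorem pushSection_apply (ζ : M → EuclideanSpace ℂ (Fin n)) (x : M) :
    pushSection φ V ζ (φ x) = V (ζ x) :=
  congrArg (fun x => V (ζ x)) (φ.symm_apply_apply x)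

theorem contMDiffOn_pushSection
    (hζ : ContMDiffOn 𝓘(ℝ, Model m) 𝓘(ℝ, EuclideanSpace ℂ (Fin n)) ∞ ζ U) :
    ContMDiffOn 𝓘(ℝ, Model m) 𝓘(ℝ, EuclideanSpace ℂ (Fin n)) ∞ (pushSection φ V ζ) (φ '' U) := by
  refine V.toRealCLM.contMDiff.comp_contMDiffOn (hζ.comp φ.symm.contMDiff.contMDiffOn ?_)
  rintro _ ⟨x, hx, rfl⟩
  simpa using hx

theorem dvec_pushSection (hU : IsOpen U)
    (hζ : ContMDiffOn 𝓘(ℝ, Model m) 𝓘(ℝ, EuclideanSpace ℂ (Fin n)) ∞ ζ U) {x : M} (hx : x ∈ U)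
    (v : TangentSpace 𝓘(ℝ, Model m) x) :
    dvec (pushSection φ V ζ) (φ x) (mfderiv 𝓘(ℝ, Model m) 𝓘(ℝ, Model m) φ x v) =
      V (dvec ζ x v) := by
  have hφU : φ '' U ∈ 𝓝 (φ x) :=
    (φ.toHomeomorph.isOpenMap U hU).mem_nhds (Set.mem_image_of_mem φ hx)
  have hsection := ((contMDiffOn_pushSection (V := V) hζ).contMDiffAt hφU).mdifferentiableAt
    (by simp)
  have hζx := ((hζ.contMDiffAt (hU.mem_nhds hx)).mdifferentiableAt (by simp)).hasMFDerivAt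
  have hVζ : HasMFDerivAt 𝓘(ℝ, Model m) 𝓘(ℝ, EuclideanSpace ℂ (Fin n)) (pushSection φ V ζ ∘ φ) x
      (V.toRealCLM.comp (dvec ζ x)) := by
    rw [show pushSection φ V ζ ∘ φ = V.toRealCLM ∘ ζ from funext (pushSection_apply ζ)]
    exact (V.toRealCLM.hasMFDerivAt (x := ζ x)).comp x hζx
  exact DFunLike.congr_fun
    ((mfderiv_comp x hsection (mdifferentiableAt_diffeomorph φ x)).symm.trans hVζ.mfderiv) v

/-- The vector field `φ_* e`. -/
def pushField (φ : M ≃ₘ^∞⟮𝓘(ℝ, Model m), 𝓘(ℝ, Model m)⟯ N)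
    (e : ∀ x : M, TangentSpace 𝓘(ℝ, Model m) x) (y : N) : TangentSpace 𝓘(ℝ, Model m) y :=
  (mfderiv 𝓘(ℝ, Model m) 𝓘(ℝ, Model m) φ (φ.symm y) (e (φ.symm y)) : Model m)

theorem pushField_apply (e : ∀ x : M, TangentSpace 𝓘(ℝ, Model m) x) (x : M) :
    pushField φ e (φ x) = mfderiv 𝓘(ℝ, Model m) 𝓘(ℝ, Model m) φ x (e x) :=
  congrArg (fun x => (mfderiv 𝓘(ℝ, Model m) 𝓘(ℝ, Model m) φ x (e x) : Model m))
    (φ.symm_apply_apply x)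

theorem normalForm_pushSection (hU : IsOpen U)
    (hζ : ContMDiffOn 𝓘(ℝ, Model m) 𝓘(ℝ, EuclideanSpace ℂ (Fin n)) ∞ ζ U) {x : M} (hx : x ∈ U)
    (v : TangentSpace 𝓘(ℝ, Model m) x) :
    normalForm (pushSection φ V ζ) (φ x) (mfderiv 𝓘(ℝ, Model m) 𝓘(ℝ, Model m) φ x v) =
      normalForm ζ x v := by
  refine Eq.trans ?_ (V.inner_map_map (ζ x) (dvec ζ x v))
  rw [← pushSection_apply (φ := φ) ζ x, ← dvec_pushSection (φ := φ) hU hζ hx]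
  rfl

theorem dz_mfderiv_of_eq_heisMap {ιM : M → Heis n} {ιN : N → Heis n}
    {b : EuclideanSpace ℂ (Fin n)} {c : ℝ} (h : ∀ x, ιN (φ x) = heisMap V b c (ιM x)) {x : M}
    (hM : MDifferentiableAt 𝓘(ℝ, Model m) 𝓘(ℝ, Heis n) ιM x)
    (hN : MDifferentiableAt 𝓘(ℝ, Model m) 𝓘(ℝ, Heis n) ιN (φ x))
    (v : TangentSpace 𝓘(ℝ, Model m) x) :
    dz ιN (φ x) (mfderiv 𝓘(ℝ, Model m) 𝓘(ℝ, Model m) φ x v) = V (dz ιM x v) := by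
  have hpush := push_mfderiv_of_eq h hM hN v
  rw [mfderiv_heisMap] at hpush
  exact congrArg Prod.fst hpush

section Frame

variable {V : UnitaryMap (m + 1)} {ιM : M → Heis (m + 1)} {ιN : N → Heis (m + 1)}
  {e : Fin m → ∀ x : M, TangentSpace 𝓘(ℝ, Model m) x} {ζ : M → EuclideanSpace ℂ (Fin (m + 1))}

theorem IsDarbouxFrame.map (he : IsDarbouxFrame SM ιM U e ζ)
    (hφ : IsPHTransformation SM SN φ) (hdz : ∀ x v,
      dz ιN (φ x) (mfderiv 𝓘(ℝ, Model m) 𝓘(ℝ, Model m) φ x v) = V (dz ιM x v)) :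
    IsDarbouxFrame SN ιN (φ '' U) (fun j => pushField φ (e j)) (pushSection φ V ζ) where
  horizontal := by
    rintro _ ⟨x, hx, rfl⟩ j
    rw [pushField_apply, hφ.1, he.horizontal x hx]
  smooth j := by
    refine (contMDiffOn_pushSection (φ := φ) (V := V) (he.smooth j)).congr ?_
    rintro _ ⟨x, -, rfl⟩
    rw [pushField_apply, hdz, pushSection_apply]
  orthonormal := by
    rintro _ ⟨x, hx, rfl⟩
    simp only [pushField_apply, hdz]
    exact (he.orthonormal x hx).comp_linearIsometry V.toLinearIsometry
  normal := by
    refine ⟨contMDiffOn_pushSection he.normal.1, ?_⟩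
    rintro _ ⟨x, hx, rfl⟩ w hw
    obtain ⟨v, rfl⟩ := (mfderiv_diffeomorph_bijective φ x).2 w
    rw [hdz, pushSection_apply, V.inner_map_map]
    exact he.normal.2 x hx v ((hφ.1 x v).symm.trans hw)
  unit := by
    rintro _ ⟨x, hx, rfl⟩
    rw [pushSection_apply, V.norm_map, he.unit x hx]

theorem IsDarbouxFrame.secondCoeff_map (he : IsDarbouxFrame SM ιM U e ζ) (hU : IsOpen U)
    (hφ : IsPHTransformation SM SN φ) (hdz : ∀ x v,
      dz ιN (φ x) (mfderiv 𝓘(ℝ, Model m) 𝓘(ℝ, Model m) φ x v) = V (dz ιM x v))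
    {x : M} (hx : x ∈ U) (j k : Fin m) :
    secondCoeff SN ιN (fun j => pushField φ (e j)) (pushSection φ V ζ) (φ x) j k =
      secondCoeff SM ιM e ζ x j k := by
  rw [secondCoeff, secondCoeff, secondForm, secondForm, pushField_apply, pushField_apply, hdz,
    ← hφ.2 x _ (he.horizontal x hx k), dvec_pushSection hU he.normal.1 hx,
    dvec_pushSection hU he.normal.1 hx, ← map_smul, ← map_add, ← map_smul, V.inner_map_map]

end Frame

end Transport

/-! ### Uniqueness of the Webster connection -/

section WebsterConnection

variable {E : Type*} [NormedAddCommGroup E] [NormedSpace ℝ E]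
  {M : Type*} [TopologicalSpace M] [ChartedSpace E M]
  {S : PHData E M} {m : ℕ} {U : Set M} {e : Fin m → ∀ x : M, TangentSpace 𝓘(ℝ, E) x}
  {η η' : Fin m → ∀ x : M, TangentSpace 𝓘(ℝ, E) x →L[ℝ] ℂ}
  {Γ Γ' : Fin m → Fin m → ∀ x : M, TangentSpace 𝓘(ℝ, E) x →L[ℝ] ℂ}
  {A A' : Fin m → Fin m → M → ℂ} {x : M}

theorem websterCurvature_congr (hU : IsOpen U) (hΓ : ∀ y ∈ U, ∀ j k, Γ j k y = Γ' j k y)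
    (hx : x ∈ U) : websterCurvature S e Γ x = websterCurvature S e Γ' x := by
  have hext : ∀ j k, extD (Γ j k) x = extD (Γ' j k) x := fun j k =>
    extD_congr (by filter_upwards [hU.mem_nhds hx] with y hy using hΓ y hy j k)
  funext j l p q
  simp only [websterCurvature, hext, hΓ x hx]

/-- The contact vector `∑ c_k e_k` at `x`, for the complex structure `J` of the contact space:
its `(1,0)`-part is `∑ c_k Z_k` with `Z_k = (e_k - i J e_k) / 2`. -/
def contactVec (S : PHData E M) (e : Fin m → ∀ x : M, TangentSpace 𝓘(ℝ, E) x) (x : M)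
    (c : Fin m → ℂ) : TangentSpace 𝓘(ℝ, E) x :=
  ∑ k, ((c k).re • e k x + (c k).im • S.J x (e k x))

namespace IsWebsterConnection

theorem coform_contactVec (hW : IsWebsterConnection S U e η Γ A) (hx : x ∈ U) (j : Fin m)
    (c : Fin m → ℂ) : η j x (contactVec S e x c) = c j := by
  simp only [contactVec, map_sum, map_add, map_smul, hW.type_one_zero x hx, hW.dual x hx,
    Complex.real_smul, mul_ite, mul_one, mul_zero]
  rw [Finset.sum_eq_single j (fun k _ hk => by simp [hk.symm]) (by simp), if_pos rfl, if_pos rfl,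
    Complex.re_add_im]

theorem coform_eq_zero_of_J_eq_zero (hW : IsWebsterConnection S U e η Γ A) (hx : x ∈ U)
    (j : Fin m) {v : TangentSpace 𝓘(ℝ, E) x} (hv : S.J x v = 0) : η j x v = 0 := by
  have hI := hW.type_one_zero x hx j v
  rw [hv, map_zero] at hI
  exact (mul_eq_zero.1 hI.symm).resolve_left Complex.I_ne_zero

theorem extD_θ_eq_zero (hW : IsWebsterConnection S U e η Γ A) (hx : x ∈ U)
    {v : TangentSpace 𝓘(ℝ, E) x} (hv : ∀ k, η k x v = 0) (w : TangentSpace 𝓘(ℝ, E) x) :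
    extD S.θ x v w = 0 := by
  have h := hW.unitary x hx v w
  simpa only [hv, map_zero, zero_mul, mul_zero, sub_zero, Finset.sum_const_zero,
    Complex.ofReal_eq_zero] using h

variable [IsManifold 𝓘(ℝ, E) ∞ M]

theorem θ_J_eq_zero (hW : IsWebsterConnection S U e η Γ A) (hS : S.IsPseudohermitian m)
    (hx : x ∈ U) (p : Fin m) : S.θ x (S.J x (e p x)) = 0 :=
  hS.J_mem x _ (hW.horizontal x hx p)

theorem θ_contactVec (hW : IsWebsterConnection S U e η Γ A) (hS : S.IsPseudohermitian m)
    (hx : x ∈ U) (c : Fin m → ℂ) : S.θ x (contactVec S e x c) = 0 := by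
  simp only [contactVec, map_sum, map_add, map_smul, hW.horizontal x hx,
    hW.θ_J_eq_zero hS hx, smul_zero, add_zero, Finset.sum_const_zero]

theorem exists_reeb (hW : IsWebsterConnection S U e η Γ A) (hS : S.IsPseudohermitian m)
    (hx : x ∈ U) : ∃ T, S.θ x T = 1 ∧ S.J x T = 0 ∧ ∀ k, η k x T = 0 := by
  obtain ⟨v, hv⟩ : ∃ v, S.θ x v ≠ 0 := by
    by_contra! h
    exact hS.θ_ne_zero x (ContinuousLinearMap.ext h)
  let u : TangentSpace 𝓘(ℝ, E) x := (S.θ x v)⁻¹ • v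
  have hη : ∀ k, η k x (u - contactVec S e x (fun k => η k x u)) = 0 := fun k => by
    rw [map_sub, hW.coform_contactVec hx, sub_self]
  refine ⟨u - contactVec S e x (fun k => η k x u), ?_,
    hS.J_reeb x _ (hW.extD_θ_eq_zero hx hη), hη⟩
  rw [map_sub, hW.θ_contactVec hS hx, sub_zero, map_smul, smul_eq_mul, inv_mul_cancel₀ hv]

theorem eq_smul_add_contactVec (hW : IsWebsterConnection S U e η Γ A)
    (hS : S.IsPseudohermitian m) (hx : x ∈ U) {T : TangentSpace 𝓘(ℝ, E) x} (hθ : S.θ x T = 1)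
    (hη : ∀ k, η k x T = 0) (v : TangentSpace 𝓘(ℝ, E) x) :
    v = S.θ x v • T + contactVec S e x (fun k => η k x v) := by
  set u := v - (S.θ x v • T + contactVec S e x (fun k => η k x v)) with hu
  have hθu : S.θ x u = 0 := by
    rw [hu, map_sub, map_add, map_smul, hθ, hW.θ_contactVec hS hx, smul_eq_mul, mul_one, add_zero,
      sub_self]
  have hηu : ∀ k, η k x u = 0 := fun k => by
    rw [hu, map_sub, map_add, map_smul, hη, hW.coform_contactVec hx, smul_zero, zero_add, sub_self]
  by_contra hne
  exact (hS.levi_pos x u hθu (sub_ne_zero.2 hne)).ne' (hW.extD_θ_eq_zero hx hηu _)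

theorem coform_unique (hW : IsWebsterConnection S U e η Γ A)
    (hW' : IsWebsterConnection S U e η' Γ' A') (hS : S.IsPseudohermitian m) (hx : x ∈ U)
    (j : Fin m) : η j x = η' j x := by
  obtain ⟨T, hθ, hJ, hη⟩ := hW.exists_reeb hS hx
  ext v
  conv_rhs => rw [hW.eq_smul_add_contactVec hS hx hθ hη v]
  rw [map_add, map_smul, hW'.coform_eq_zero_of_J_eq_zero hx j hJ, smul_zero, zero_add,
    hW'.coform_contactVec hx]

theorem structure_eq_sub (hW : IsWebsterConnection S U e η Γ A)
    (hW' : IsWebsterConnection S U e η' Γ' A') (hS : S.IsPseudohermitian m) (hU : IsOpen U)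
    (hx : x ∈ U) (j : Fin m) (v w : TangentSpace 𝓘(ℝ, E) x) :
    (∑ k, wedge (η k x) (Γ k j x - Γ' k j x) v w) +
      ∑ k, (A j k x - A' j k x) *
        (S.θ x v * conj (η k x w) - S.θ x w * conj (η k x v)) = 0 := by
  have hη : ∀ k, η' k x = η k x := fun k => hW'.coform_unique hW hS hx k
  have hext : extD (η j) x = extD (η' j) x := extD_congr (by
    filter_upwards [hU.mem_nhds hx] with y hy using hW.coform_unique hW' hS hy j)
  have h := hW.structure_eq x hx j v w
  rw [hext, hW'.structure_eq x hx j v w] at h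
  simp only [hη] at h
  rw [eq_comm, ← sub_eq_zero, add_sub_add_comm, ← Finset.sum_sub_distrib,
    ← Finset.sum_sub_distrib] at h
  refine Eq.trans (congrArg₂ _ ?_ ?_) h <;> refine Finset.sum_congr rfl fun k _ => ?_
  · simp only [wedge, sub_apply]
    ring
  · ring

theorem apply_reeb_eq_zero (hW : IsWebsterConnection S U e η Γ A) (hS : S.IsPseudohermitian m)
    (hx : x ∈ U) {D : Fin m → TangentSpace 𝓘(ℝ, E) x →L[ℝ] ℂ}
    {a : Fin m → ℂ}
    (hD : ∀ v w, (∑ k, wedge (η k x) (D k) v w) +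
      ∑ k, a k * (S.θ x v * conj (η k x w) - S.θ x w * conj (η k x v)) = 0)
    {T : TangentSpace 𝓘(ℝ, E) x} (hθ : S.θ x T = 1) (hη : ∀ k, η k x T = 0) (p : Fin m) :
    D p T = 0 := by
  have hre : D p T + -a p = 0 := by
    simpa [wedge, hη, hθ, hW.horizontal x hx, hW.dual x hx, apply_ite conj] using hD (e p x) T
  have him : Complex.I * D p T + a p * Complex.I = 0 := by
    simpa [wedge, hη, hθ, hW.θ_J_eq_zero hS hx, hW.dual x hx, hW.type_one_zero x hx,
      apply_ite conj] using hD (S.J x (e p x)) T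
  have h : Complex.I * (2 * D p T) = 0 := by linear_combination him + Complex.I * hre
  simpa using h

theorem apply_J_eq (hW : IsWebsterConnection S U e η Γ A) (hS : S.IsPseudohermitian m)
    (hx : x ∈ U) {D : Fin m → TangentSpace 𝓘(ℝ, E) x →L[ℝ] ℂ}
    {a : Fin m → ℂ}
    (hD : ∀ v w, (∑ k, wedge (η k x) (D k) v w) +
      ∑ k, a k * (S.θ x v * conj (η k x w) - S.θ x w * conj (η k x v)) = 0) (p q : Fin m) :
    D q (S.J x (e p x)) = Complex.I * D q (e p x) := by
  have hre : D p (e q x) - D q (e p x) = 0 := by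
    simpa [wedge, hW.horizontal x hx, hW.dual x hx, Finset.sum_sub_distrib] using
      hD (e p x) (e q x)
  have him : Complex.I * D p (e q x) - D q (S.J x (e p x)) = 0 := by
    simpa [wedge, hW.horizontal x hx, hW.θ_J_eq_zero hS hx, hW.dual x hx, hW.type_one_zero x hx,
      Finset.sum_sub_distrib] using hD (S.J x (e p x)) (e q x)
  linear_combination Complex.I * hre - him

theorem conn_unique (hW : IsWebsterConnection S U e η Γ A)
    (hW' : IsWebsterConnection S U e η' Γ' A') (hS : S.IsPseudohermitian m) (hU : IsOpen U)
    (hx : x ∈ U) (j k : Fin m) : Γ j k x = Γ' j k x := by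
  obtain ⟨T, hθ, -, hη⟩ := hW.exists_reeb hS hx
  let D : Fin m → Fin m → TangentSpace 𝓘(ℝ, E) x →L[ℝ] ℂ := fun j k => Γ j k x - Γ' j k x
  have hstr := hW.structure_eq_sub hW' hS hU hx
  have hskew : ∀ j k v, D j k v + conj (D k j v) = 0 := fun j k v => by
    simp only [D, sub_apply, map_sub]
    linear_combination hW.skew x hx j k v - hW'.skew x hx j k v
  have hDT : ∀ j k, D j k T = 0 := fun j k => hW.apply_reeb_eq_zero hS hx (hstr k) hθ hη j
  have hDJ : ∀ j k p, D j k (S.J x (e p x)) = Complex.I * D j k (e p x) := fun j k p =>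
    hW.apply_J_eq hS hx (hstr k) p j
  have hDe : ∀ j k p, D j k (e p x) = 0 := fun j k p => by
    have hJ := hskew j k (S.J x (e p x))
    rw [hDJ, hDJ, map_mul, Complex.conj_I] at hJ
    have h : Complex.I * (2 * D j k (e p x)) = 0 := by
      linear_combination hJ + Complex.I * hskew j k (e p x)
    simpa using h
  suffices h : D j k = 0 from sub_eq_zero.1 h
  ext v
  rw [hW.eq_smul_add_contactVec hS hx hθ hη v, zero_apply]
  simp only [contactVec, map_add, map_sum, map_smul, hDT, hDJ, hDe, smul_zero, mul_zero, add_zero,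
    Finset.sum_const_zero]

end IsWebsterConnection

end WebsterConnection

/-! ### Darboux frames -/

section Frames

variable {m : ℕ}

theorem inner_eq_sum_add {Z : Fin m → EuclideanSpace ℂ (Fin (m + 1))}
    {ζ : EuclideanSpace ℂ (Fin (m + 1))} (hZ : Orthonormal ℂ Z) (hζ : ‖ζ‖ = 1)
    (hζZ : ∀ j, inner ℂ ζ (Z j) = 0) (a b : EuclideanSpace ℂ (Fin (m + 1))) :
    inner ℂ a b = (∑ k, inner ℂ a (Z k) * inner ℂ (Z k) b) + inner ℂ a ζ * inner ℂ ζ b := by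
  let F : Option (Fin m) → EuclideanSpace ℂ (Fin (m + 1)) := fun o => o.elim ζ Z
  have hF : Orthonormal ℂ F := by
    rw [orthonormal_iff_ite] at hZ ⊢
    rintro (_ | j) (_ | k)
    · simp [F, inner_self_eq_norm_sq_to_K, hζ]
    · simpa [F] using hζZ k
    · simpa [F] using inner_eq_zero_symm.1 (hζZ j)
    · simpa [F] using hZ j k
  have hspan : ⊤ ≤ Submodule.span ℂ (Set.range F) :=
    (hF.linearIndependent.span_eq_top_of_card_eq_finrank' (by simp)).ge
  rw [← (OrthonormalBasis.mk hF hspan).sum_inner_mul_inner a b, Fintype.sum_option, add_comm]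
  simp [F]

variable {n : ℕ} {M : Type*} [TopologicalSpace M] [ChartedSpace (Model m) M]

theorem connForm_apply (Z W : M → EuclideanSpace ℂ (Fin n)) (x : M)
    (v : TangentSpace 𝓘(ℝ, Model m) x) : connForm Z W x v = inner ℂ (W x) (dvec Z x v) := rfl

theorem inner_dvec_left (Z W : M → EuclideanSpace ℂ (Fin n)) (x : M)
    (v : TangentSpace 𝓘(ℝ, Model m) x) :
    inner ℂ (dvec Z x v) (W x) = conj (connForm Z W x v) :=
  (inner_conj_symm _ _).symm

theorem conj_connForm {Z W : M → EuclideanSpace ℂ (Fin n)} {x : M}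
    (hZ : MDifferentiableAt 𝓘(ℝ, Model m) 𝓘(ℝ, EuclideanSpace ℂ (Fin n)) Z x)
    (hW : MDifferentiableAt 𝓘(ℝ, Model m) 𝓘(ℝ, EuclideanSpace ℂ (Fin n)) W x)
    (h : ∀ᶠ y in 𝓝 x, inner ℂ (Z y) (W y) = inner ℂ (Z x) (W x))
    (v : TangentSpace 𝓘(ℝ, Model m) x) :
    conj (connForm Z W x v) = -connForm W Z x v := by
  have hZW : HasMFDerivAt 𝓘(ℝ, Model m)
      𝓘(ℝ, EuclideanSpace ℂ (Fin n) × EuclideanSpace ℂ (Fin n)) (fun y => (Z y, W y)) x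
      ((dvec Z x).prod (dvec W x)) :=
    ⟨hZ.continuousAt.prodMk hW.continuousAt, hZ.hasMFDerivAt.2.prodMk hW.hasMFDerivAt.2⟩
  have hinner := HasMFDerivAt.comp (I'' := 𝓘(ℝ, ℂ)) x
    ((isBoundedBilinearMap_inner (𝕜 := ℂ)).hasFDerivAt (Z x, W x)).hasMFDerivAt hZW
  have hconst := (hasMFDerivAt_const (I := 𝓘(ℝ, Model m)) (I' := 𝓘(ℝ, ℂ)) (inner ℂ (Z x) (W x))
    x).congr_of_eventuallyEq h
  have hsum : connForm W Z x v + inner ℂ (dvec Z x v) (W x) = 0 :=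
    DFunLike.congr_fun (hasMFDerivAt_unique hinner hconst) v
  rw [← inner_dvec_left, eq_neg_of_add_eq_zero_right hsum]

variable [IsManifold 𝓘(ℝ, Model m) ∞ M]

theorem extD_connForm {Z W : M → EuclideanSpace ℂ (Fin n)} {x : M}
    (hZ : ContMDiffAt 𝓘(ℝ, Model m) 𝓘(ℝ, EuclideanSpace ℂ (Fin n)) ∞ Z x)
    (hW : ContMDiffAt 𝓘(ℝ, Model m) 𝓘(ℝ, EuclideanSpace ℂ (Fin n)) ∞ W x)
    (v w : TangentSpace 𝓘(ℝ, Model m) x) :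
    extD (connForm Z W) x v w =
      inner ℂ (dvec W x v) (dvec Z x w) - inner ℂ (dvec W x w) (dvec Z x v) := by
  have hd : HasMFDerivAt 𝓘(ℝ, Model m) 𝓘(ℝ, EuclideanSpace ℂ (Fin n) →L[ℝ] ℂ)
      (fun y => innerR n (W y)) x ((innerR n).comp (dvec W x)) :=
    ((innerR n).hasMFDerivAt (x := W x)).comp x (hW.mdifferentiableAt (by simp)).hasMFDerivAt
  have hext := extD_comp_mfderiv hd.mdifferentiableAt (hZ.of_le ENat.LEInfty.out) v w
  rwa [hd.mfderiv] at hext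

theorem smoothFormOn_connForm {Z W : M → EuclideanSpace ℂ (Fin n)} {U : Set M} (hU : IsOpen U)
    (hZ : ContMDiffOn 𝓘(ℝ, Model m) 𝓘(ℝ, EuclideanSpace ℂ (Fin n)) ∞ Z U)
    (hW : ContMDiffOn 𝓘(ℝ, Model m) 𝓘(ℝ, EuclideanSpace ℂ (Fin n)) ∞ W U) :
    SmoothFormOn (connForm (m := m) Z W) U :=
  smoothFormOn_comp_mfderiv (a := fun y => innerR n (W y)) hU
    ((innerR n).contMDiff.comp_contMDiffOn hW) hZ

end Frames

section Algebra

theorem eq_zero_of_wedge_eq_zero {V : Type*} [AddCommGroup V] [Module ℝ V] [TopologicalSpace V]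
    {α β : V →L[ℝ] ℂ} {v v' : V} (hv : α v ≠ 0) (hv' : α v' = Complex.I * α v)
    (hre : ∀ w, (β w).re = 0) (h : ∀ v w, wedge α β v w = 0) : β = 0 := by
  have hwedge : ∀ w, α v * β w = α w * β v := fun w => sub_eq_zero.1 (h v w)
  have hβv' : β v' = Complex.I * β v := mul_left_cancel₀ hv (by
    rw [hwedge, hv']
    ring)
  have hβv : β v = 0 := Complex.ext (hre v) (by
    have him := congrArg Complex.re hβv'
    rwa [hre, Complex.I_mul_re, eq_comm, neg_eq_zero] at him)
  ext w
  have hw := hwedge w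
  rw [hβv, mul_zero] at hw
  exact (mul_eq_zero.1 hw).resolve_left hv

theorem exists_phase_of_mul_conj_eq {ι₁ ι₂ : Type*} {h k : ι₁ → ι₂ → ℂ} (h0 : ∃ j l, h j l ≠ 0)
    (hk : ∀ j l p q, k j p * conj (k l q) = h j p * conj (h l q)) :
    ∃ u : ℂ, ‖u‖ = 1 ∧ ∀ j l, k j l = u * h j l := by
  obtain ⟨l, q, hlq⟩ := h0
  have hnorm : ‖k l q‖ = ‖h l q‖ := by
    have hsq := hk l l q q
    rw [Complex.mul_conj, Complex.mul_conj, Complex.ofReal_inj, Complex.normSq_eq_norm_sq,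
      Complex.normSq_eq_norm_sq] at hsq
    exact (sq_eq_sq₀ (norm_nonneg _) (norm_nonneg _)).1 hsq
  have hne : conj (k l q) ≠ 0 := by
    rwa [map_ne_zero, ← norm_ne_zero_iff, hnorm, norm_ne_zero_iff]
  refine ⟨conj (h l q) / conj (k l q), ?_, fun j p => ?_⟩
  · rw [norm_div, RCLike.norm_conj, RCLike.norm_conj, hnorm, div_self (norm_ne_zero_iff.2 hlq)]
  · rw [div_mul_eq_mul_div, eq_div_iff hne, hk, mul_comm]

end Algebra

section Darboux

variable {m : ℕ} {M : Type*} [TopologicalSpace M] [ChartedSpace (Model m) M]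
  {S : PHData (Model m) M} {ι : M → Heis (m + 1)} {U : Set M}
  {e : Fin m → ∀ x : M, TangentSpace 𝓘(ℝ, Model m) x} {ζ : M → EuclideanSpace ℂ (Fin (m + 1))}

/-- The section `Z_j` of `T_{1,0} H_n` along `M`, in the left invariant frame. -/
def frameVec (ι : M → Heis (m + 1)) (e : Fin m → ∀ x : M, TangentSpace 𝓘(ℝ, Model m) x)
    (j : Fin m) (x : M) : EuclideanSpace ℂ (Fin (m + 1)) := dz ι x (e j x)

/-- The form `θ^j = ⟨dz, Z_j⟩` of the coframe dual to a Darboux frame. -/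
def frameCoform (ι : M → Heis (m + 1)) (e : Fin m → ∀ x : M, TangentSpace 𝓘(ℝ, Model m) x)
    (j : Fin m) (x : M) : TangentSpace 𝓘(ℝ, Model m) x →L[ℝ] ℂ :=
  connForm (fun y => (ι y).1) (frameVec ι e j) x

/-- The tangential connection form `θ_j^k = ⟨∇ Z_j, Z_k⟩` of a Darboux frame. -/
def frameConn (ι : M → Heis (m + 1)) (e : Fin m → ∀ x : M, TangentSpace 𝓘(ℝ, Model m) x)
    (j k : Fin m) (x : M) : TangentSpace 𝓘(ℝ, Model m) x →L[ℝ] ℂ :=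
  connForm (frameVec ι e j) (frameVec ι e k) x

namespace IsDarbouxFrame

variable {x : M}

theorem contMDiffAt_frameVec (he : IsDarbouxFrame S ι U e ζ) (hU : IsOpen U) (hx : x ∈ U)
    (j : Fin m) : ContMDiffAt 𝓘(ℝ, Model m) 𝓘(ℝ, EuclideanSpace ℂ (Fin (m + 1))) ∞
      (frameVec ι e j) x :=
  (he.smooth j).contMDiffAt (hU.mem_nhds hx)

theorem contMDiffAt_normal (he : IsDarbouxFrame S ι U e ζ) (hU : IsOpen U) (hx : x ∈ U) :
    ContMDiffAt 𝓘(ℝ, Model m) 𝓘(ℝ, EuclideanSpace ℂ (Fin (m + 1))) ∞ ζ x :=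
  he.normal.1.contMDiffAt (hU.mem_nhds hx)

theorem inner_frameVec (he : IsDarbouxFrame S ι U e ζ) (hx : x ∈ U) (j k : Fin m) :
    inner ℂ (frameVec ι e j x) (frameVec ι e k x) = if j = k then 1 else 0 :=
  orthonormal_iff_ite.1 (he.orthonormal x hx) j k

theorem inner_frameVec_normal (he : IsDarbouxFrame S ι U e ζ) (hx : x ∈ U) (j : Fin m) :
    inner ℂ (frameVec ι e j x) (ζ x) = 0 :=
  he.normal.2 x hx _ (he.horizontal x hx j)

theorem inner_normal_frameVec (he : IsDarbouxFrame S ι U e ζ) (hx : x ∈ U) (j : Fin m) :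
    inner ℂ (ζ x) (frameVec ι e j x) = 0 :=
  inner_eq_zero_symm.1 (he.inner_frameVec_normal hx j)

theorem inner_normal_normal (he : IsDarbouxFrame S ι U e ζ) (hx : x ∈ U) :
    inner ℂ (ζ x) (ζ x) = 1 := by
  rw [inner_self_eq_norm_sq_to_K, he.unit x hx, RCLike.ofReal_one, one_pow]

theorem eventually_inner_frameVec (he : IsDarbouxFrame S ι U e ζ) (hU : IsOpen U) (hx : x ∈ U)
    (j k : Fin m) : ∀ᶠ y in 𝓝 x, inner ℂ (frameVec ι e j y) (frameVec ι e k y) =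
      inner ℂ (frameVec ι e j x) (frameVec ι e k x) := by
  filter_upwards [hU.mem_nhds hx] with y hy
  rw [he.inner_frameVec hy, he.inner_frameVec hx]

theorem eventually_inner_normal_frameVec (he : IsDarbouxFrame S ι U e ζ) (hU : IsOpen U)
    (hx : x ∈ U) (j : Fin m) : ∀ᶠ y in 𝓝 x, inner ℂ (ζ y) (frameVec ι e j y) =
      inner ℂ (ζ x) (frameVec ι e j x) := by
  filter_upwards [hU.mem_nhds hx] with y hy
  rw [he.inner_normal_frameVec hy, he.inner_normal_frameVec hx]

theorem eventually_inner_frameVec_normal (he : IsDarbouxFrame S ι U e ζ) (hU : IsOpen U)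
    (hx : x ∈ U) (j : Fin m) : ∀ᶠ y in 𝓝 x, inner ℂ (frameVec ι e j y) (ζ y) =
      inner ℂ (frameVec ι e j x) (ζ x) := by
  filter_upwards [hU.mem_nhds hx] with y hy
  rw [he.inner_frameVec_normal hy, he.inner_frameVec_normal hx]

theorem eventually_inner_normal_normal (he : IsDarbouxFrame S ι U e ζ) (hU : IsOpen U)
    (hx : x ∈ U) : ∀ᶠ y in 𝓝 x, inner ℂ (ζ y) (ζ y) = inner ℂ (ζ x) (ζ x) := by
  filter_upwards [hU.mem_nhds hx] with y hy
  rw [he.inner_normal_normal hy, he.inner_normal_normal hx]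

theorem conj_frameConn (he : IsDarbouxFrame S ι U e ζ) (hU : IsOpen U) (hx : x ∈ U)
    (j k : Fin m) (v : TangentSpace 𝓘(ℝ, Model m) x) :
    conj (frameConn ι e j k x v) = -frameConn ι e k j x v :=
  conj_connForm ((he.contMDiffAt_frameVec hU hx j).mdifferentiableAt (by simp))
    ((he.contMDiffAt_frameVec hU hx k).mdifferentiableAt (by simp))
    (he.eventually_inner_frameVec hU hx j k) v

theorem inner_dvec_normal_frameVec (he : IsDarbouxFrame S ι U e ζ) (hU : IsOpen U) (hx : x ∈ U)
    (j : Fin m) (v : TangentSpace 𝓘(ℝ, Model m) x) :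
    inner ℂ (dvec ζ x v) (frameVec ι e j x) = -mixedForm ι e ζ j x v := by
  rw [inner_dvec_left]
  exact conj_connForm ((he.contMDiffAt_normal hU hx).mdifferentiableAt (by simp))
    ((he.contMDiffAt_frameVec hU hx j).mdifferentiableAt (by simp))
    (he.eventually_inner_normal_frameVec hU hx j) v

theorem connForm_normal_frameVec (he : IsDarbouxFrame S ι U e ζ) (hU : IsOpen U) (hx : x ∈ U)
    (j : Fin m) (v : TangentSpace 𝓘(ℝ, Model m) x) :
    connForm ζ (frameVec ι e j) x v = -conj (mixedForm ι e ζ j x v) := by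
  rw [← map_neg, ← he.inner_dvec_normal_frameVec hU hx, inner_conj_symm, connForm_apply]

theorem normalForm_re (he : IsDarbouxFrame S ι U e ζ) (hU : IsOpen U) (hx : x ∈ U)
    (v : TangentSpace 𝓘(ℝ, Model m) x) : (normalForm ζ x v).re = 0 := by
  have hζ := (he.contMDiffAt_normal hU hx).mdifferentiableAt (by simp)
  have hconj : conj (normalForm ζ x v) = -normalForm ζ x v :=
    conj_connForm hζ hζ (he.eventually_inner_normal_normal hU hx) v
  exact self_eq_neg.1 (congrArg Complex.re hconj)

variable [IsManifold 𝓘(ℝ, Model m) ∞ M]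

/-- The curvature of the flat connection of `H_n` vanishes: in the frame `Z_1, …, Z_m, ζ` this is
`dθ = θ ∧ θ`, which contains the Gauss and the Codazzi equation. -/
theorem extD_connForm_eq_sum_wedge (he : IsDarbouxFrame S ι U e ζ) (hU : IsOpen U) (hx : x ∈ U)
    {Z W : M → EuclideanSpace ℂ (Fin (m + 1))}
    (hZ : ContMDiffAt 𝓘(ℝ, Model m) 𝓘(ℝ, EuclideanSpace ℂ (Fin (m + 1))) ∞ Z x)
    (hW : ContMDiffAt 𝓘(ℝ, Model m) 𝓘(ℝ, EuclideanSpace ℂ (Fin (m + 1))) ∞ W x)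
    (hWe : ∀ k, ∀ᶠ y in 𝓝 x, inner ℂ (W y) (frameVec ι e k y) = inner ℂ (W x) (frameVec ι e k x))
    (hWζ : ∀ᶠ y in 𝓝 x, inner ℂ (W y) (ζ y) = inner ℂ (W x) (ζ x))
    (v w : TangentSpace 𝓘(ℝ, Model m) x) :
    extD (connForm Z W) x v w =
      (∑ k, wedge (connForm Z (frameVec ι e k) x) (connForm (frameVec ι e k) W x) v w) +
        wedge (connForm Z ζ x) (connForm ζ W x) v w := by
  have hW' := hW.mdifferentiableAt (by simp)
  have hparseval : ∀ v w : TangentSpace 𝓘(ℝ, Model m) x, inner ℂ (dvec W x v) (dvec Z x w) =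
      -((∑ k, connForm (frameVec ι e k) W x v * connForm Z (frameVec ι e k) x w) +
        connForm ζ W x v * connForm Z ζ x w) := fun v w => by
    rw [inner_eq_sum_add (he.orthonormal x hx) (he.unit x hx) (he.inner_normal_frameVec hx),
      inner_dvec_left, conj_connForm hW' ((he.contMDiffAt_normal hU hx).mdifferentiableAt (by simp))
        hWζ, neg_add, ← Finset.sum_neg_distrib, neg_mul, connForm_apply Z ζ]
    refine congrArg (· + _) (Finset.sum_congr rfl fun k _ => ?_)
    rw [← neg_mul, ← conj_connForm hW'
      ((he.contMDiffAt_frameVec hU hx k).mdifferentiableAt (by simp)) (hWe k), ← inner_dvec_left]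
    rfl
  rw [extD_connForm hZ hW, hparseval, hparseval]
  simp only [wedge, Finset.sum_sub_distrib, mul_comm (connForm _ W x _)]
  ring

theorem extD_frameConn (he : IsDarbouxFrame S ι U e ζ) (hU : IsOpen U) (hx : x ∈ U)
    (j l : Fin m) (v w : TangentSpace 𝓘(ℝ, Model m) x) :
    extD (frameConn ι e j l) x v w =
      (∑ k, wedge (frameConn ι e j k x) (frameConn ι e k l x) v w) +
        wedge (mixedForm ι e ζ j x) (connForm ζ (frameVec ι e l) x) v w :=
  he.extD_connForm_eq_sum_wedge hU hx (he.contMDiffAt_frameVec hU hx j)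
    (he.contMDiffAt_frameVec hU hx l) (fun k => he.eventually_inner_frameVec hU hx l k)
    (he.eventually_inner_frameVec_normal hU hx l) v w

theorem extD_mixedForm (he : IsDarbouxFrame S ι U e ζ) (hU : IsOpen U) (hx : x ∈ U)
    (j : Fin m) (v w : TangentSpace 𝓘(ℝ, Model m) x) :
    extD (mixedForm ι e ζ j) x v w =
      (∑ k, wedge (frameConn ι e j k x) (mixedForm ι e ζ k x) v w) +
        wedge (mixedForm ι e ζ j x) (normalForm ζ x) v w :=
  he.extD_connForm_eq_sum_wedge hU hx (he.contMDiffAt_frameVec hU hx j)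
    (he.contMDiffAt_normal hU hx) (he.eventually_inner_normal_frameVec hU hx)
    (he.eventually_inner_normal_normal hU hx) v w

theorem frameCoform_apply (h : IsPHSubmanifold S ι) (j : Fin m)
    (v : TangentSpace 𝓘(ℝ, Model m) x) :
    frameCoform ι e j x v = inner ℂ (frameVec ι e j x) (dz ι x v) := by
  rw [frameCoform, connForm_apply, dvec_fst (h.mdifferentiableAt x)]

theorem inner_dz_eq_sum (he : IsDarbouxFrame S ι U e ζ) (h : IsPHSubmanifold S ι)
    (hv : IsVertical S ι) (hx : x ∈ U) (a : EuclideanSpace ℂ (Fin (m + 1)))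
    (v : TangentSpace 𝓘(ℝ, Model m) x) :
    inner ℂ a (dz ι x v) = ∑ k, inner ℂ a (frameVec ι e k x) * frameCoform ι e k x v := by
  rw [inner_eq_sum_add (he.orthonormal x hx) (he.unit x hx) (he.inner_normal_frameVec hx),
    h.inner_normal_dz hv he.normal hx, mul_zero, add_zero]
  simp only [frameCoform_apply h, frameVec]

theorem secondCoeff_eq (he : IsDarbouxFrame S ι U e ζ) (h : IsPHSubmanifold S ι)
    (hv : IsVertical S ι) (hU : IsOpen U) (hx : x ∈ U) (j k : Fin m) :
    secondCoeff S ι e ζ x j k = mixedForm ι e ζ j x (e k x) := by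
  rw [secondCoeff, h.secondForm_eq hv hU he.normal hx]
  exact neg_eq_iff_eq_neg.2 (he.inner_dvec_normal_frameVec hU hx j (e k x))

theorem secondCoeff_comm (he : IsDarbouxFrame S ι U e ζ) (h : IsPHSubmanifold S ι)
    (hv : IsVertical S ι) (hU : IsOpen U) (hx : x ∈ U) (j k : Fin m) :
    secondCoeff S ι e ζ x j k = secondCoeff S ι e ζ x k j := by
  rw [secondCoeff, secondCoeff, h.secondForm_eq hv hU he.normal hx,
    h.secondForm_eq hv hU he.normal hx, h.inner_dvec_dz_comm hv hU he.normal hx]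

theorem mixedForm_eq_sum (he : IsDarbouxFrame S ι U e ζ) (h : IsPHSubmanifold S ι)
    (hv : IsVertical S ι) (hU : IsOpen U) (hx : x ∈ U) (j : Fin m)
    (v : TangentSpace 𝓘(ℝ, Model m) x) :
    mixedForm ι e ζ j x v = ∑ k, secondCoeff S ι e ζ x j k * frameCoform ι e k x v := by
  rw [← neg_eq_iff_eq_neg.2 (he.inner_dvec_normal_frameVec hU hx j v), frameVec,
    h.inner_dvec_dz_comm hv hU he.normal hx, he.inner_dz_eq_sum h hv hx, ← Finset.sum_neg_distrib]
  refine Finset.sum_congr rfl fun k _ => ?_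
  rw [he.inner_dvec_normal_frameVec hU hx, ← he.secondCoeff_eq h hv hU hx,
    he.secondCoeff_comm h hv hU hx, neg_mul, neg_neg]

theorem mixedForm_J (he : IsDarbouxFrame S ι U e ζ) (h : IsPHSubmanifold S ι)
    (hv : IsVertical S ι) (hU : IsOpen U) (hx : x ∈ U) (j : Fin m)
    (v : TangentSpace 𝓘(ℝ, Model m) x) :
    mixedForm ι e ζ j x (S.J x v) = Complex.I * mixedForm ι e ζ j x v := by
  rw [← neg_eq_iff_eq_neg.2 (he.inner_dvec_normal_frameVec hU hx j v),
    ← neg_eq_iff_eq_neg.2 (he.inner_dvec_normal_frameVec hU hx j (S.J x v)), mul_neg]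
  exact congrArg Neg.neg (h.inner_dvec_J_dz hv hU he.normal hx v (e j x))

theorem extD_θ_eq_sum (he : IsDarbouxFrame S ι U e ζ) (h : IsPHSubmanifold S ι)
    (hv : IsVertical S ι) (hx : x ∈ U) (v w : TangentSpace 𝓘(ℝ, Model m) x) :
    ((extD S.θ x v w : ℝ) : ℂ) = Complex.I * ∑ j, (frameCoform ι e j x v *
      conj (frameCoform ι e j x w) - frameCoform ι e j x w * conj (frameCoform ι e j x v)) := by
  have hinner : ∀ v w : TangentSpace 𝓘(ℝ, Model m) x, inner ℂ (dz ι x v) (dz ι x w) =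
      ∑ j, frameCoform ι e j x w * conj (frameCoform ι e j x v) := fun v w => by
    rw [he.inner_dz_eq_sum h hv hx]
    refine Finset.sum_congr rfl fun j _ => ?_
    rw [frameCoform_apply h j v, inner_conj_symm, mul_comm]
  rw [h.extD_θ, Finset.sum_sub_distrib, ← hinner w v, ← hinner v w,
    ← inner_conj_symm (dz ι x w) (dz ι x v), ← neg_sub, Complex.sub_conj, Complex.ofReal_mul,
    Complex.ofReal_ofNat]
  linear_combination (2 * ((inner ℂ (dz ι x v) (dz ι x w) : ℂ).im : ℂ)) * Complex.I_sq

theorem extD_frameCoform (he : IsDarbouxFrame S ι U e ζ) (h : IsPHSubmanifold S ι)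
    (hv : IsVertical S ι) (hU : IsOpen U) (hx : x ∈ U) (j : Fin m)
    (v w : TangentSpace 𝓘(ℝ, Model m) x) :
    extD (frameCoform ι e j) x v w =
      ∑ k, wedge (frameCoform ι e k x) (frameConn ι e k j x) v w := by
  have hζ : connForm (m := m) (fun y => (ι y).1) ζ x = 0 := ContinuousLinearMap.ext fun u => by
    rw [connForm_apply, dvec_fst (h.mdifferentiableAt x)]
    exact h.inner_normal_dz hv he.normal hx u
  refine (he.extD_connForm_eq_sum_wedge hU hx (h.contMDiffAt_fst x)
    (he.contMDiffAt_frameVec hU hx j) (fun k => he.eventually_inner_frameVec hU hx j k)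
    (he.eventually_inner_frameVec_normal hU hx j) v w).trans ?_
  simp only [hζ, wedge, zero_apply, zero_mul, sub_self, add_zero, frameCoform, frameConn]

theorem isWebsterConnection (he : IsDarbouxFrame S ι U e ζ) (h : IsPHSubmanifold S ι)
    (hv : IsVertical S ι) (hU : IsOpen U) :
    IsWebsterConnection S U e (frameCoform ι e) (frameConn ι e) (fun _ _ _ => 0) where
  smooth_η j := smoothFormOn_connForm hU (fun y _ => (h.contMDiffAt_fst y).contMDiffWithinAt)
    (he.smooth j)
  smooth_Γ j k := smoothFormOn_connForm hU (he.smooth j) (he.smooth k)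
  horizontal := he.horizontal
  dual x hx j k := (frameCoform_apply h j (e k x)).trans (he.inner_frameVec hx j k)
  type_one_zero x _ j v := by
    rw [frameCoform_apply h, frameCoform_apply h, h.dz_J hv, inner_smul_right]
  unitary _ hx := he.extD_θ_eq_sum h hv hx
  structure_eq x hx j v w := by
    simp only [he.extD_frameCoform h hv hU hx, zero_mul, Finset.sum_const_zero, add_zero]
  skew x hx j k v := by rw [he.conj_frameConn hU hx, add_neg_cancel]

theorem websterCurvature_frameConn (he : IsDarbouxFrame S ι U e ζ) (h : IsPHSubmanifold S ι)
    (hv : IsVertical S ι) (hU : IsOpen U) (hx : x ∈ U) (j l p q : Fin m) :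
    websterCurvature S e (frameConn ι e) x j l p q =
      -(secondCoeff S ι e ζ x j p * conj (secondCoeff S ι e ζ x l q)) := by
  simp only [websterCurvature, he.extD_frameConn hU hx, add_sub_cancel_left, wedge,
    he.connForm_normal_frameVec hU hx, he.mixedForm_J h hv hU hx, he.secondCoeff_eq h hv hU hx,
    map_mul, Complex.conj_I]
  ring_nf
  simp only [Complex.I_sq]
  ring

section AnyWebsterConnection

variable {η : Fin m → ∀ x : M, TangentSpace 𝓘(ℝ, Model m) x →L[ℝ] ℂ}
  {Γ : Fin m → Fin m → ∀ x : M, TangentSpace 𝓘(ℝ, Model m) x →L[ℝ] ℂ}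
  {A : Fin m → Fin m → M → ℂ}

theorem coform_eq (he : IsDarbouxFrame S ι U e ζ) (h : IsPHSubmanifold S ι)
    (hv : IsVertical S ι) (hU : IsOpen U) (hW : IsWebsterConnection S U e η Γ A) (hx : x ∈ U)
    (j : Fin m) : η j x = frameCoform ι e j x :=
  hW.coform_unique (he.isWebsterConnection h hv hU) h.pseudohermitian hx j

theorem conn_eq (he : IsDarbouxFrame S ι U e ζ) (h : IsPHSubmanifold S ι)
    (hv : IsVertical S ι) (hU : IsOpen U) (hW : IsWebsterConnection S U e η Γ A) (hx : x ∈ U)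
    (j k : Fin m) : Γ j k x = frameConn ι e j k x :=
  hW.conn_unique (he.isWebsterConnection h hv hU) h.pseudohermitian hU hx j k

theorem websterCurvature_eq (he : IsDarbouxFrame S ι U e ζ) (h : IsPHSubmanifold S ι)
    (hv : IsVertical S ι) (hU : IsOpen U) (hW : IsWebsterConnection S U e η Γ A) (hx : x ∈ U)
    (j l p q : Fin m) : websterCurvature S e Γ x j l p q =
      -(secondCoeff S ι e ζ x j p * conj (secondCoeff S ι e ζ x l q)) := by
  rw [websterCurvature_congr hU (fun _ hy => he.conn_eq h hv hU hW hy) hx,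
    he.websterCurvature_frameConn h hv hU hx]

end AnyWebsterConnection

theorem exists_secondCoeff_ne_zero (he : IsDarbouxFrame S ι U e ζ) (h : IsPHSubmanifold S ι)
    (hv : IsVertical S ι) (hU : IsOpen U) (hx : x ∈ U) (hf : ¬ IsFlatPoint S ι x) :
    ∃ j k, secondCoeff S ι e ζ x j k ≠ 0 := by
  by_contra! hII
  have hmixed : ∀ j v, mixedForm ι e ζ j x v = 0 := fun j v => by
    simp only [he.mixedForm_eq_sum h hv hU hx, hII, zero_mul, Finset.sum_const_zero]
  have hdvec : ∀ u v : TangentSpace 𝓘(ℝ, Model m) x,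
      inner ℂ (dvec ζ x u) (dz ι x v) = 0 := fun u v => by
    simp only [he.inner_dz_eq_sum h hv hx, he.inner_dvec_normal_frameVec hU hx, hmixed, neg_zero,
      zero_mul, Finset.sum_const_zero]
  have hζ : ζ x = 0 := by
    have hmem : ζ x ∈ (⊤ : Submodule ℂ _)ᗮ := h.span_jetFamily hv hf ▸ mem_orthogonal_span_range ?_
    · rwa [Submodule.top_orthogonal_eq_bot, Submodule.mem_bot] at hmem
    rintro (v | ⟨u, v⟩)
    · rw [jetFamily, Sum.elim_inl, h.fderiv_zInChart_self]
      exact h.inner_normal_dz hv he.normal hx v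
    · exact (h.inner_normal_fderiv_fderiv hv hU he.normal hx u v).trans
        (neg_eq_zero.2 (hdvec u v))
  have hunit := he.unit x hx
  rw [hζ, norm_zero] at hunit
  exact zero_ne_one hunit

theorem eq_normalForm (he : IsDarbouxFrame S ι U e ζ) (h : IsPHSubmanifold S ι)
    (hv : IsVertical S ι) (hU : IsOpen U) (hx : x ∈ U) (hf : ¬ IsFlatPoint S ι x)
    {α : TangentSpace 𝓘(ℝ, Model m) x →L[ℝ] ℂ} (hα : ∀ v, (α v).re = 0)
    (hC : ∀ j v w, extD (mixedForm ι e ζ j) x v w =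
      (∑ k, wedge (frameConn ι e j k x) (mixedForm ι e ζ k x) v w) +
        wedge (mixedForm ι e ζ j x) α v w) : α = normalForm ζ x := by
  obtain ⟨j, k, hjk⟩ := he.exists_secondCoeff_ne_zero h hv hU hx hf
  rw [he.secondCoeff_eq h hv hU hx] at hjk
  refine sub_eq_zero.1 (eq_zero_of_wedge_eq_zero hjk (he.mixedForm_J h hv hU hx j _)
    (fun v => ?_) fun v w => ?_)
  · rw [sub_apply, Complex.sub_re, hα, he.normalForm_re hU hx, sub_zero]
  · have hw := hC j v w
    rw [he.extD_mixedForm hU hx, add_right_inj] at hw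
    simp only [wedge, sub_apply] at hw ⊢
    linear_combination -hw

end IsDarbouxFrame

end Darboux

end Pseudohermitian

end

theorem theoremC_general (m : ℕ)
    {M : Type*} [TopologicalSpace M] [ChartedSpace (Model m) M] [IsManifold 𝓘(ℝ, Model m) ∞ M]
    [ConnectedSpace M]
    {N : Type*} [TopologicalSpace N] [ChartedSpace (Model m) N] [IsManifold 𝓘(ℝ, Model m) ∞ N]
    (SM : PHData (Model m) M) (ιM : M → Heis (m + 1)) (hM : IsPHSubmanifold SM ιM)
    (hMv : IsVertical SM ιM) (hMf : ∀ x, ¬ IsFlatPoint SM ιM x)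
    (SN : PHData (Model m) N) (ιN : N → Heis (m + 1)) (hN : IsPHSubmanifold SN ιN)
    (hNv : IsVertical SN ιN) :
    (∀ φ : M ≃ₘ^∞⟮𝓘(ℝ, Model m), 𝓘(ℝ, Model m)⟯ N,
      IsPHTransformation SM SN φ ↔
        ∃ Φ : Heis (m + 1) ≃ₘ^∞⟮𝓘(ℝ, Heis (m + 1)), 𝓘(ℝ, Heis (m + 1))⟯ Heis (m + 1),
          IsRigidMotion Φ ∧ ∀ x, ιN (φ x) = Φ (ιM x)) ∧
    (∀ (U : Set M) (e : Fin m → ∀ x : M, TangentSpace 𝓘(ℝ, Model m) x)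
      (ζ : M → EuclideanSpace ℂ (Fin (m + 1))), IsOpen U → IsDarbouxFrame SM ιM U e ζ →
      (∃ η Γ A, IsWebsterConnection SM U e η Γ A) ∧
      ∀ η Γ A, IsWebsterConnection SM U e η Γ A → ∀ x ∈ U,
        (∀ j k, secondCoeff SM ιM e ζ x j k = secondCoeff SM ιM e ζ x k j) ∧
        (∀ j v, mixedForm ιM e ζ j x v = ∑ k, secondCoeff SM ιM e ζ x j k * η k x v) ∧
        (∀ j l p q, websterCurvature SM e Γ x j l p q =
          -(secondCoeff SM ιM e ζ x j p * (starRingEnd ℂ) (secondCoeff SM ιM e ζ x l q))) ∧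
        (∀ k : Fin m → Fin m → ℂ,
          (∀ j l p q, websterCurvature SM e Γ x j l p q =
            -(k j p * (starRingEnd ℂ) (k l q))) →
          ∃ u : ℂ, ‖u‖ = 1 ∧ ∀ j l, k j l = u * secondCoeff SM ιM e ζ x j l) ∧
        (∀ j v w, extD (mixedForm ιM e ζ j) x v w =
          (∑ k, wedge (Γ j k x) (mixedForm ιM e ζ k x) v w) +
            wedge (mixedForm ιM e ζ j x) (normalForm ζ x) v w) ∧
        (∀ α : TangentSpace 𝓘(ℝ, Model m) x →L[ℝ] ℂ, (∀ v, (α v).re = 0) →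
          (∀ j v w, extD (mixedForm ιM e ζ j) x v w =
            (∑ k, wedge (Γ j k x) (mixedForm ιM e ζ k x) v w) +
              wedge (mixedForm ιM e ζ j x) α v w) →
          α = normalForm ζ x)) ∧
    (∀ φ : M ≃ₘ^∞⟮𝓘(ℝ, Model m), 𝓘(ℝ, Model m)⟯ N, IsPHTransformation SM SN φ →
      ∀ (U : Set M) (e : Fin m → ∀ x : M, TangentSpace 𝓘(ℝ, Model m) x)
        (ζ : M → EuclideanSpace ℂ (Fin (m + 1))), IsOpen U → IsDarbouxFrame SM ιM U e ζ →
      ∃ (e' : Fin m → ∀ y : N, TangentSpace 𝓘(ℝ, Model m) y)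
        (ζ' : N → EuclideanSpace ℂ (Fin (m + 1))), IsDarbouxFrame SN ιN (φ '' U) e' ζ' ∧
        (∀ x ∈ U, ∀ j,
          e' j (φ x) = mfderiv 𝓘(ℝ, Model m) 𝓘(ℝ, Model m) φ x (e j x)) ∧
        (∀ x ∈ U, ∀ j k, secondCoeff SN ιN e' ζ' (φ x) j k = secondCoeff SM ιM e ζ x j k) ∧
        (∀ x ∈ U, ∀ v,
          normalForm ζ' (φ x) (mfderiv 𝓘(ℝ, Model m) 𝓘(ℝ, Model m) φ x v) =
            normalForm ζ x v)) := by
  refine ⟨fun φ => isPHTransformation_iff_exists_isRigidMotion hM hMv hMf hN hNv,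
    fun U e ζ hU he => ⟨⟨_, _, _, he.isWebsterConnection hM hMv hU⟩, fun η Γ A hW x hx => ?_⟩,
    fun φ hφ U e ζ hU he => ?_⟩
  · have hR := he.websterCurvature_eq hM hMv hU hW hx
    simp only [he.coform_eq hM hMv hU hW hx, he.conn_eq hM hMv hU hW hx]
    exact ⟨he.secondCoeff_comm hM hMv hU hx, he.mixedForm_eq_sum hM hMv hU hx, hR,
      fun k hk => exists_phase_of_mul_conj_eq (he.exists_secondCoeff_ne_zero hM hMv hU hx (hMf x))
        fun j l p q => neg_injective ((hk j l p q).symm.trans (hR j l p q)),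
      he.extD_mixedForm hU hx, fun α => he.eq_normalForm hM hMv hU hx (hMf x)⟩
  · obtain ⟨V, b, c, h⟩ := hφ.exists_eq_heisMap hM hMv hMf hN hNv
    have hdz := fun x v => dz_mfderiv_of_eq_heisMap h (hM.mdifferentiableAt x)
      (hN.mdifferentiableAt _) v
    exact ⟨fun j => pushField φ (e j), pushSection φ V ζ, he.map hφ hdz,
      fun x _ j => pushField_apply (e j) x, fun x hx => he.secondCoeff_map hU hφ hdz hx,
      fun x hx v => normalForm_pushSection hU he.normal.1 hx v⟩

theorem theoremC (m : ℕ) (hm : 1 ≤ m)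
    {M : Type*} [TopologicalSpace M] [ChartedSpace (Model m) M] [IsManifold 𝓘(ℝ, Model m) ∞ M]
    [SimplyConnectedSpace M]
    {N : Type*} [TopologicalSpace N] [ChartedSpace (Model m) N] [IsManifold 𝓘(ℝ, Model m) ∞ N]
    [SimplyConnectedSpace N]
    (SM : PHData (Model m) M) (ιM : M → Heis (m + 1)) (hM : IsPHSubmanifold SM ιM)
    (hMv : IsVertical SM ιM) (hMf : ∀ x, ¬ IsFlatPoint SM ιM x)
    (SN : PHData (Model m) N) (ιN : N → Heis (m + 1)) (hN : IsPHSubmanifold SN ιN)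
    (hNv : IsVertical SN ιN) (hNf : ∀ y, ¬ IsFlatPoint SN ιN y) :
    -- a diffeomorphism is a pseudohermitian transformation iff it is the restriction of a
    -- Heisenberg rigid motion
    (∀ φ : M ≃ₘ^∞⟮𝓘(ℝ, Model m), 𝓘(ℝ, Model m)⟯ N,
      IsPHTransformation SM SN φ ↔
        ∃ Φ : Heis (m + 1) ≃ₘ^∞⟮𝓘(ℝ, Heis (m + 1)), 𝓘(ℝ, Heis (m + 1))⟯ Heis (m + 1),
          IsRigidMotion Φ ∧ ∀ x, ιN (φ x) = Φ (ιM x)) ∧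
    -- the Gauss-like and Codazzi-like equations, and what they determine
    (∀ (U : Set M) (e : Fin m → ∀ x : M, TangentSpace 𝓘(ℝ, Model m) x)
      (ζ : M → EuclideanSpace ℂ (Fin (m + 1))), IsOpen U → IsDarbouxFrame SM ιM U e ζ →
      (∃ η Γ A, IsWebsterConnection SM U e η Γ A) ∧
      ∀ η Γ A, IsWebsterConnection SM U e η Γ A → ∀ x ∈ U,
        -- `II` is symmetric and `θ_j^n = ∑ h_{jk} θ^k`
        (∀ j k, secondCoeff SM ιM e ζ x j k = secondCoeff SM ιM e ζ x k j) ∧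
        (∀ j v, mixedForm ιM e ζ j x v = ∑ k, secondCoeff SM ιM e ζ x j k * η k x v) ∧
        -- the Gauss-like equation
        (∀ j l p q, websterCurvature SM e Γ x j l p q =
          -(secondCoeff SM ιM e ζ x j p * (starRingEnd ℂ) (secondCoeff SM ιM e ζ x l q))) ∧
        -- it determines `II` up to the choice of the unit normal
        (∀ k : Fin m → Fin m → ℂ,
          (∀ j l p q, websterCurvature SM e Γ x j l p q =
            -(k j p * (starRingEnd ℂ) (k l q))) →
          ∃ u : ℂ, ‖u‖ = 1 ∧ ∀ j l, k j l = u * secondCoeff SM ιM e ζ x j l) ∧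
        -- the Codazzi-like equation
        (∀ j v w, extD (mixedForm ιM e ζ j) x v w =
          (∑ k, wedge (Γ j k x) (mixedForm ιM e ζ k x) v w) +
            wedge (mixedForm ιM e ζ j x) (normalForm ζ x) v w) ∧
        -- it determines the normal connection
        (∀ α : TangentSpace 𝓘(ℝ, Model m) x →L[ℝ] ℂ, (∀ v, (α v).re = 0) →
          (∀ j v w, extD (mixedForm ιM e ζ j) x v w =
            (∑ k, wedge (Γ j k x) (mixedForm ιM e ζ k x) v w) +
              wedge (mixedForm ιM e ζ j x) α v w) →
          α = normalForm ζ x)) ∧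
    -- hence `II` and the normal connection are invariants of the induced structure
    (∀ φ : M ≃ₘ^∞⟮𝓘(ℝ, Model m), 𝓘(ℝ, Model m)⟯ N, IsPHTransformation SM SN φ →
      ∀ (U : Set M) (e : Fin m → ∀ x : M, TangentSpace 𝓘(ℝ, Model m) x)
        (ζ : M → EuclideanSpace ℂ (Fin (m + 1))), IsOpen U → IsDarbouxFrame SM ιM U e ζ →
      ∃ (e' : Fin m → ∀ y : N, TangentSpace 𝓘(ℝ, Model m) y)
        (ζ' : N → EuclideanSpace ℂ (Fin (m + 1))), IsDarbouxFrame SN ιN (φ '' U) e' ζ' ∧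
        (∀ x ∈ U, ∀ j,
          e' j (φ x) = mfderiv 𝓘(ℝ, Model m) 𝓘(ℝ, Model m) φ x (e j x)) ∧
        (∀ x ∈ U, ∀ j k, secondCoeff SN ιN e' ζ' (φ x) j k = secondCoeff SM ιM e ζ x j k) ∧
        (∀ x ∈ U, ∀ v,
          normalForm ζ' (φ x) (mfderiv 𝓘(ℝ, Model m) 𝓘(ℝ, Model m) φ x v) =
            normalForm ζ x v)) :=
  theoremC_general m SM ιM hM hMv hMf SN ιN hN hNv
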